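/- **Setting.** Let $d\ge 1$ and let $\mathcal X\subset\mathbb R^d$ be nonempty, bounded and Borel, with the property that every nonempty relatively open subset of $\mathcal X$ has positive Lebesgue measure. Let $D\supseteq\mathcal X$ be a set which, near each of its points and along each coordinate direction, is a full interval or a half-interval with endpoint at that point (for instance $D$ open, or $D=\mathcal X$ a box); partial derivatives on $D$ are one-sided where $D$ is. Let $y=(y(x))_{x\in D}$ be a Gaussian process with mean $\mu(x)=\sum_{k=1}^q p_k(x)\beta_k$ and covariance $\sigma^2R(x,x')$, $\sigma>0$. Let $$\mathcal F_x[f](x)=\sum_{i=1}^L c_i(x)\,\nabla_{\alpha_i}f(x),\qquad \nabla_{\alpha}=\partial_{x_1}^{\alpha_1}\cdots\partial_{x_d}^{\alpha_d},$$ be a linear differential operator, and let $R^{\mathcal F\mathcal F}(x,x')=\mathcal F_x[\mathcal F_{x'}[R]](x,x')$. Assume that the derivatives of the $p_k$ occurring in $\mathcal F[p_k]$ exist on $D$; that $R$ is smooth enough for $\mathcal F_x\times\mathcal F_{x'}$, i.e. all derivatives of $R$ formed on the way to $\mathcal F_x[\mathcal F_{x'}[R]]$ exist and are continuous on $D\times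 D$; that $R^{\mathcal F\mathcal F}$ is continuous on $\mathcal X\times\mathcal X$ (automatic if the $c_i$ are continuous on $\mathcal X$); and that $\int_{\mathcal X}|R^{\mathcal F\mathcal F}(x,x)|\,dx<\infty$ (then automatic if $\mathcal X$ is compact). **Theorem.** 1. The PDE process $y^{\mathcal F}(x)=\sum_i c_i(x)\nabla_{\alpha_i}y(x)$, $x\in\mathcal X$, with derivatives in mean square, exists. It is a Gaussian process with $\operatorname{Cov}(y^{\mathcal F}(x),y^{\mathcal F}(x'))=\sigma^2R^{\mathcal F\mathcal F}(x,x')$. 2. There are $\xi_1\ge\xi_2\ge\cdots\ge0$ and functions $\varepsilon_1,\varepsilon_2,\dots$, orthonormal in $L^2(\mathcal X)$, with $\int_{\mathcal X}R^{\mathcal F\mathcal F}(x,x')\varepsilon_i(x')\,dx'=\xi_i\varepsilon_i(x)$ for all $i$ and all $x\in\mathcal X$, and $$R^{\mathcal F\mathcal F}(x,x')=\sum_{i=1}^\infty\xi_i\,\varepsilon_i(x)\,\varepsilon_i(x')\qquad(x,x'\in\mathcal X).$$ 3. For every $m\ge0$ and all $x_1,\dots,x_m\in\mathcal X$, the conditional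 variance $\operatorname{Var}[y^{\mathcal F}(x)\mid y^{\mathcal F}(x_1),\dots,y^{\mathcal F}(x_m)]$ is almost surely a constant for each $x\in\mathcal X$, and this constant is integrable in $x$ over $\mathcal X$. With $$\mathrm{VRR}(\{x_j\}_{j=1}^m;y^{\mathcal F})=\frac{\int_{\mathcal X}\operatorname{Var}[y^{\mathcal F}(x)]\,dx-\int_{\mathcal X}\operatorname{Var}[y^{\mathcal F}(x)\mid y^{\mathcal F}(x_1),\dots,y^{\mathcal F}(x_m)]\,dx}{\int_{\mathcal X}\operatorname{Var}[y^{\mathcal F}(x)]\,dx},$$ every expansion as in 2 satisfies $\sum_j\xi_j<\infty$ and $$\sup_{x_1,\dots,x_m\in\mathcal X}\mathrm{VRR}(\{x_j\}_{j=1}^m;y^{\mathcal F})\le\frac{\sum_{j=1}^m\xi_j}{\sum_{j=1}^\infty\xi_j}$$ (with $0/0:=0$ in the degenerate case $R^{\mathcal F\mathcal F}=0$ on $\mathcal X\times\mathcal X$). -/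

import Mathlib

open MeasureTheory ProbabilityTheory Filter Topology Set

/-- `ℝᵈ` with its Euclidean norm and Lebesgue measure. -/
abbrev Pt (d : ℕ) : Type := EuclideanSpace ℝ (Fin d)

/-- The set of admissible steps from `x` in the `i`-th coordinate direction inside `D`:
all `h` with `x + h eᵢ ∈ D`. -/
def axisSection {d : ℕ} (D : Set (Pt d)) (i : Fin d) (x : Pt d) : Set ℝ :=
  {h : ℝ | x + h • EuclideanSpace.single i (1 : ℝ) ∈ D}

/-- Domains on which (possibly one-sided) coordinate derivatives make sense: near every point of
`D`, and along every coordinate direction, `D` looks like a full interval or like a half-interval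
with endpoint at this point. Open sets and boxes (open, closed or half-open) are of this kind. -/
def AxisRegular {d : ℕ} (D : Set (Pt d)) : Prop :=
  ∀ x ∈ D, ∀ i : Fin d, ∃ δ : ℝ, 0 < δ ∧
    (axisSection D i x ∩ Icc (-δ) δ = Icc (-δ) δ ∨
      axisSection D i x ∩ Icc (-δ) δ = Icc 0 δ ∨
      axisSection D i x ∩ Icc (-δ) δ = Icc (-δ) 0)

/-- The word of coordinate directions of a multi-index `α`; the head is the derivative that is
applied last, so the word stands for `∂₁^{α₁} ⋯ ∂_d^{α_d}`. -/
def multiIndexWord {d : ℕ} (α : Fin d → ℕ) : List (Fin d) :=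
  (List.finRange d).flatMap fun i => List.replicate (α i) i

section Functions

/-- `∂f/∂xᵢ` on `D` (one-sided at points where `D` is one-sided). -/
noncomputable def partialOn {d : ℕ} (D : Set (Pt d)) (i : Fin d) (f : Pt d → ℝ) : Pt d → ℝ :=
  fun x => derivWithin (fun h : ℝ => f (x + h • EuclideanSpace.single i (1 : ℝ)))
    (axisSection D i x) 0

/-- `∂f/∂xᵢ` exists at all points of `D`. -/
def HasPartialOn {d : ℕ} (D : Set (Pt d)) (i : Fin d) (f : Pt d → ℝ) : Prop :=
  ∀ x ∈ D, DifferentiableWithinAt ℝ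
    (fun h : ℝ => f (x + h • EuclideanSpace.single i (1 : ℝ))) (axisSection D i x) 0

/-- Iterated partial derivative along a word of directions. -/
noncomputable def wordDeriv {d : ℕ} (D : Set (Pt d)) : List (Fin d) → (Pt d → ℝ) → (Pt d → ℝ)
  | [], f => f
  | i :: w, f => partialOn D i (wordDeriv D w f)

/-- All the derivatives that occur in `wordDeriv D w f` exist on `D`. -/
def HasWordDeriv {d : ℕ} (D : Set (Pt d)) : List (Fin d) → (Pt d → ℝ) → Prop
  | [], _ => True
  | i :: w, f => HasWordDeriv D w f ∧ HasPartialOn D i (wordDeriv D w f)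

/-- A linear differential operator `F[y](x) = ∑ᵢ cᵢ(x) ∇_{αᵢ} y(x)` with `L` terms. -/
structure LinDiffOp (d : ℕ) where
  L : ℕ
  coeff : Fin L → Pt d → ℝ
  index : Fin L → Fin d → ℕ

/-- The word of the multi-index of the `i`-th term. -/
def LinDiffOp.word {d : ℕ} (F : LinDiffOp d) (i : Fin F.L) : List (Fin d) :=
  multiIndexWord (F.index i)

/-- `F[f]` for a real function `f` on `D`. -/
noncomputable def LinDiffOp.apply {d : ℕ} (F : LinDiffOp d) (D : Set (Pt d)) (f : Pt d → ℝ) :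
    Pt d → ℝ :=
  fun x => ∑ i, F.coeff i x * wordDeriv D (F.word i) f x

/-- All the derivatives of `f` that occur in `F[f]` exist on `D`. -/
def LinDiffOp.Exists {d : ℕ} (F : LinDiffOp d) (D : Set (Pt d)) (f : Pt d → ℝ) : Prop :=
  ∀ i, HasWordDeriv D (F.word i) f

/-- `R^{FF}(x, x') = (F_x × F_{x'})[R](x, x') = F_x[F_{x'}[R]](x, x')`. -/
noncomputable def LinDiffOp.kernel {d : ℕ} (F : LinDiffOp d) (D : Set (Pt d))
    (R : Pt d → Pt d → ℝ) : Pt d → Pt d → ℝ :=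
  fun x x' => F.apply D (fun s => F.apply D (R s) x') x

/-- `R` is smooth enough for `(F_x × F_{x'})[R]`: all the derivatives of `R` in the second and then
in the first variable that are formed on the way to `F_x[F_{x'}[R]]` exist on `D × D` and are
continuous there. (The suffixes of the word of a multi-index are the derivatives that are formed
on the way to the derivative with this multi-index.) -/
structure LinDiffOp.KernelSmooth {d : ℕ} (F : LinDiffOp d) (D : Set (Pt d))
    (R : Pt d → Pt d → ℝ) : Prop where
  exists_snd : ∀ s ∈ D, F.Exists D (R s)
  exists_fst : ∀ j, ∀ v, v <:+ F.word j → ∀ t ∈ D,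
    F.Exists D (fun s => wordDeriv D v (R s) t)
  continuousOn : ∀ i j, ∀ u v, u <:+ F.word i → v <:+ F.word j →
    ContinuousOn
      (fun p : Pt d × Pt d => wordDeriv D u (fun s => wordDeriv D v (R s) p.2) p.1) (D ×ˢ D)

end Functions

section Processes

/-- `g` is the mean-square partial derivative of the process `f` in direction `i` on `D`. -/
def IsMSPartial {d : ℕ} {Ω : Type*} [MeasurableSpace Ω] (P : Measure Ω) (D : Set (Pt d))
    (i : Fin d) (f g : Pt d → Ω → ℝ) : Prop :=
  ∀ x ∈ D, MemLp (g x) 2 P ∧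
    Tendsto
      (fun h : ℝ => eLpNorm
        (fun ω => h⁻¹ * (f (x + h • EuclideanSpace.single i (1 : ℝ)) ω - f x ω) - g x ω) 2 P)
      (𝓝[axisSection D i x \ {0}] 0) (𝓝 0)

/-- `g` is the iterated mean-square derivative of the process `f` along a word of directions. -/
def IsMSDeriv {d : ℕ} {Ω : Type*} [MeasurableSpace Ω] (P : Measure Ω) (D : Set (Pt d)) :
    List (Fin d) → (Pt d → Ω → ℝ) → (Pt d → Ω → ℝ) → Prop
  | [], f, g => ∀ x ∈ D, g x =ᵐ[P] f x
  | i :: w, f, g => ∃ k, IsMSDeriv P D w f k ∧ IsMSPartial P D i k g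

/-- `z` is (a version of) the PDE process `y^F = F[y] = ∑ᵢ cᵢ ∇_{αᵢ} y` on `X`, where the process
`y` lives on `D ⊇ X` and its derivatives are taken in mean square. -/
def LinDiffOp.IsPDEVersion {d : ℕ} (F : LinDiffOp d) {Ω : Type*} [MeasurableSpace Ω]
    (P : Measure Ω) (D X : Set (Pt d)) (y z : Pt d → Ω → ℝ) : Prop :=
  ∃ g : Fin F.L → Pt d → Ω → ℝ,
    (∀ i, IsMSDeriv P D (F.word i) y (g i)) ∧
    ∀ x ∈ X, Measurable (z x) ∧ z x =ᵐ[P] fun ω => ∑ i, F.coeff i x * g i x ω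

/-- The Gaussian process model on `D`: `y ~ GP(pᵀβ, σ² R)`. -/
structure IsGPModel {d : ℕ} {Ω : Type*} [MeasurableSpace Ω] (P : Measure Ω) (D : Set (Pt d))
    (y : Pt d → Ω → ℝ) {q : ℕ} (p : Fin q → Pt d → ℝ) (β : Fin q → ℝ) (σ : ℝ)
    (R : Pt d → Pt d → ℝ) : Prop where
  gaussian : IsGaussianProcess (fun (x : D) ω => y x ω) P
  mean : ∀ x ∈ D, ∫ ω, y x ω ∂P = ∑ k, p k x * β k
  cov : ∀ x ∈ D, ∀ x' ∈ D, cov[y x, y x'; P] = σ ^ 2 * R x x'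

/-- The conditional variance `Var[z(x) | z(x₁), …, z(x_m)]` as a random variable. -/
noncomputable def condVarAt {d : ℕ} {Ω : Type*} [MeasurableSpace Ω] (P : Measure Ω)
    (z : Pt d → Ω → ℝ) {m : ℕ} (pts : Fin m → Pt d) (x : Pt d) : Ω → ℝ :=
  condVar (MeasurableSpace.comap (fun ω (j : Fin m) => z (pts j) ω) inferInstance) (z x) P

/-- The posterior variance as a number: the mean of the conditional variance (for jointly
Gaussian variables the conditional variance is almost surely constant, so this is its value). -/
noncomputable def posteriorVar {d : ℕ} {Ω : Type*} [MeasurableSpace Ω] (P : Measure Ω)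
    (z : Pt d → Ω → ℝ) {m : ℕ} (pts : Fin m → Pt d) (x : Pt d) : ℝ :=
  ∫ ω, condVarAt P z pts x ω ∂P

/-- The variance reduction ratio `VRR({x₁, …, x_m}; z(·))` over `X`. -/
noncomputable def VRR {d : ℕ} {Ω : Type*} [MeasurableSpace Ω] (P : Measure Ω) (X : Set (Pt d))
    (z : Pt d → Ω → ℝ) {m : ℕ} (pts : Fin m → Pt d) : ℝ :=
  ((∫ x in X, Var[z x; P]) - ∫ x in X, posteriorVar P z pts x) / ∫ x in X, Var[z x; P]

end Processes

/-- `K(x, x') = ∑ᵢ ξᵢ εᵢ(x) εᵢ(x')` on `X × X` with `ξ₀ ≥ ξ₁ ≥ ⋯ ≥ 0` eigenvalues of the integral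
operator of `K` on `L²(X)` and `εᵢ` corresponding orthonormal eigenfunctions. -/
structure IsMercerExpansion {d : ℕ} (X : Set (Pt d)) (K : Pt d → Pt d → ℝ) (ξ : ℕ → ℝ)
    (ε : ℕ → Pt d → ℝ) : Prop where
  antitone : Antitone ξ
  nonneg : ∀ i, 0 ≤ ξ i
  memLp : ∀ i, MemLp (ε i) 2 (volume.restrict X)
  orthonormal : ∀ i j, ∫ x in X, ε i x * ε j x = if i = j then 1 else 0
  eigen : ∀ i, ∀ x ∈ X, ∫ x' in X, K x x' * ε i x' = ξ i * ε i x
  hasSum : ∀ x ∈ X, ∀ x' ∈ X, HasSum (fun i => ξ i * ε i x * ε i x') (K x x')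

/-! Everything takes place in the Hilbert space `L²(P)`. After removing the mean and the factor `σ`,
the process is a map `Y : D → L²(P)` with Gram kernel `R`, and mean-square derivatives are norm
derivatives of `Y`. By the mean value theorem, a double difference of `R` divided by both steps is a
nearby value of the mixed derivative. Inner products of difference quotients of `Y` therefore have a
common limit, so the quotients are Cauchy (`exists_hasDerivWithinAt_of_gram`). Iteration along a
word needs derivatives in the two variables to commute, which is a one-sided Schwarz theorem
(`hasDerivWithinAt_swap`). Thus `U = F[Y]` exists and has Gram kernel `R^{FF}`. It stays in the
closed span of `Y`, which consists of centred Gaussian variables because characteristic functions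
are continuous on `L²(P)`.

Mercer's expansion uses no compactness of `X`. Since `U` is continuous and square integrable, `S h =
⟪U(·), h⟫` is a Hilbert–Schmidt operator into `L²(X)`, and `S S*` is the integral operator of the
kernel. Diagonalising `S S*` gives eigenvectors `eₙ`; the normalised nonzero `S* eₙ` form a Hilbert
basis of the closed span of `U`, and Parseval for `⟪U x, U x'⟫` is the pointwise expansion
(`exists_mercer_of_total`).

For the bound, orthogonality is independence for jointly Gaussian variables, so a conditional
variance is a squared distance to a span (`condVar_ae_eq_of_gaussian`). The explained variance is
thus, up to `σ²`, the squared norm of a projection onto a space of dimension at most `m`. In the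
coordinates `√ξᵢ εᵢ(x)` its integral is `∑ ξᵢ wᵢ` with weights in `[0, 1]` of total mass at most
`m`, hence at most the sum of the first `m` eigenvalues
(`IsMercerExpansion.exists_reduction_bound`). -/

/-! ### Spectral theory of positive compact operators -/

section Operators

open Module.End
open scoped RealInnerProductSpace

variable {E H : Type*} [NormedAddCommGroup E] [InnerProductSpace ℝ E]
  [NormedAddCommGroup H] [InnerProductSpace ℝ H]

/-- A bounded operator which is square summable along a Hilbert basis is compact. -/
theorem isCompactOperator_of_hilbertSchmidt [CompleteSpace E] {ι : Type*}
    (b : HilbertBasis ι ℝ H) (S : H →L[ℝ] E) (hS : Summable fun i => ‖S (b i)‖ ^ 2) :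
    IsCompactOperator S := by
  classical
  let S' : Finset ι → H →L[ℝ] E := fun s =>
    ∑ i ∈ s, (innerSL ℝ (b i)).smulRight (S (b i))
  have hS' : ∀ s x, S' s x = ∑ i ∈ s, ⟪b i, x⟫ • S (b i) := fun s x => by
    simp [S']
  have hcomp : ∀ s, IsCompactOperator (S' s) := by
    intro s
    have : ∀ i, IsCompactOperator ((innerSL ℝ (b i)).smulRight (S (b i)) : H →L[ℝ] E) := by
      intro i
      have h : IsCompactOperator (innerSL ℝ (b i)) :=
        isCompactOperator_of_locallyCompactSpace_dom (T := innerSL ℝ (b i))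
      exact h.clm_comp (ContinuousLinearMap.toSpanSingleton ℝ (S (b i)))
    have hm : S' s ∈ compactOperator (RingHom.id ℝ) H E := Submodule.sum_mem _ fun i _ => this i
    exact hm
  refine isCompactOperator_of_tendsto (l := atTop) (F := S') ?_ (Eventually.of_forall hcomp)
  have htail := (tendsto_tsum_compl_atTop_zero fun i => ‖S (b i)‖ ^ 2)
  -- Cauchy–Schwarz splits the tail of `∑ ⟪b i, x⟫ • S (b i)`; Bessel bounds one factor by `‖x‖`,
  -- the other is a tail of the convergent series.
  have hbound : ∀ s, ‖S' s - S‖ ≤ √(∑' i : { i // i ∉ s }, ‖S (b i)‖ ^ 2) := by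
    intro s
    refine ContinuousLinearMap.opNorm_le_bound _ (Real.sqrt_nonneg _) fun x => ?_
    have hx : HasSum (fun i => ⟪b i, x⟫ • S (b i)) (S x) := by
      have := (b.hasSum_repr x).mapL S
      simpa [b.repr_apply_apply] using this
    refine le_of_tendsto (f := fun t : Finset ι => ‖S' s x - ∑ i ∈ t, ⟪b i, x⟫ • S (b i)‖)
      (x := atTop) ?_ ?_
    · exact (tendsto_const_nhds.sub hx).norm
    · filter_upwards [eventually_ge_atTop s] with t hst
      rw [hS', ← Finset.sum_sdiff hst, norm_sub_rev, add_sub_cancel_right]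
      calc ‖∑ i ∈ t \ s, ⟪b i, x⟫ • S (b i)‖ ≤ ∑ i ∈ t \ s, ‖S (b i)‖ * |⟪b i, x⟫| := by
            refine (norm_sum_le _ _).trans_eq (Finset.sum_congr rfl fun i _ => ?_)
            rw [norm_smul, Real.norm_eq_abs, mul_comm]
        _ ≤ √(∑ i ∈ t \ s, ‖S (b i)‖ ^ 2) * √(∑ i ∈ t \ s, |⟪b i, x⟫| ^ 2) :=
            Real.sum_mul_le_sqrt_mul_sqrt _ _ _
        _ ≤ √(∑' i : { i // i ∉ s }, ‖S (b i)‖ ^ 2) * ‖x‖ := by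
            gcongr
            · have h1 := Summable.sum_le_tsum (f := fun i : { i // i ∉ s } => ‖S (b i)‖ ^ 2)
                ((t \ s).subtype (· ∉ s)) (fun i _ => sq_nonneg _)
                (hS.subtype _)
              refine le_trans (le_of_eq ?_) h1
              rw [Finset.sum_subtype_eq_sum_filter (f := fun i => ‖S (b i)‖ ^ 2)]
              refine Finset.sum_congr ?_ fun _ _ => rfl
              ext i; simp +contextual
            · refine Real.sqrt_le_iff.2 ⟨norm_nonneg _, ?_⟩
              exact b.orthonormal.sum_inner_products_le x
  rw [tendsto_iff_norm_sub_tendsto_zero]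
  refine squeeze_zero (fun _ => norm_nonneg _) hbound ?_
  simpa [Function.comp_def] using (Real.continuous_sqrt.tendsto 0).comp htail

/-- The norm of a nonzero positive compact operator is an eigenvalue. -/
theorem hasEigenvalue_norm_of_isPositive [CompleteSpace E] {T : E →L[ℝ] E}
    (hc : IsCompactOperator T) (hT : T.IsPositive) (h0 : T ≠ 0) :
    HasEigenvalue (T : Module.End ℝ E) ‖T‖ := by
  have hne : ‖T‖ ≠ 0 := norm_ne_zero_iff.2 h0
  -- Fredholm alternative. In the resolvent case the Rayleigh quotients would stay a fixed `ε` below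
  -- `‖T‖`, although their supremum is `‖T‖`.
  refine (hc.hasEigenvalue_or_mem_resolventSet hne).resolve_right fun hres => ?_
  have : Nontrivial E := by
    by_contra h
    rw [not_nontrivial_iff_subsingleton] at h
    exact h0 (Subsingleton.elim _ _)
  obtain ⟨ε, hε, h⟩ := T.rayleighQuotient_le_of_norm_mem_resolventSet (by simpa using hres)
  have h1 : ‖T‖ ≤ ‖T‖ - ε := by
    conv_lhs => rw [T.norm_eq_iSup_rayleighQuotient hT.isSymmetric]
    refine ciSup_le fun x => ?_
    rw [abs_of_nonneg]
    · exact h x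
    · exact div_nonneg (hT.re_inner_nonneg_left x) (sq_nonneg _)
  linarith

/-- A positive compact operator on a closed invariant infinite-dimensional subspace has a unit
eigenvector there whose eigenvalue bounds the quadratic form. -/
theorem exists_top_eigenvector [CompleteSpace E] {T : E →L[ℝ] E} (hc : IsCompactOperator T)
    (hT : T.IsPositive) (V : Submodule ℝ E) (hVc : IsClosed (V : Set E)) (hV : ∀ v ∈ V, T v ∈ V)
    (hVi : ¬ FiniteDimensional ℝ V) :
    ∃ e ∈ V, ‖e‖ = 1 ∧ ∃ c : ℝ, 0 ≤ c ∧ T e = c • e ∧ ∀ f ∈ V, ⟪T f, f⟫ ≤ c * ‖f‖ ^ 2 := by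
  have : CompleteSpace V := hVc.completeSpace_coe
  let TV : V →L[ℝ] V := T.restrict hV
  have hTV : ∀ v : V, (TV v : E) = T v := fun v => rfl
  have hcV : IsCompactOperator TV := hc.restrict' hV
  have hpV : TV.IsPositive := by
    refine ⟨hT.isSymmetric.restrict_invariant hV, fun x => ?_⟩
    exact hT.re_inner_nonneg_left (x : E)
  have hbound : ∀ f ∈ V, ⟪T f, f⟫ ≤ ‖TV‖ * ‖f‖ ^ 2 := by
    intro f hf
    have h1 : ⟪TV ⟨f, hf⟩, (⟨f, hf⟩ : V)⟫ ≤ ‖TV ⟨f, hf⟩‖ * ‖(⟨f, hf⟩ : V)‖ := real_inner_le_norm _ _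
    have h2 := TV.le_opNorm ⟨f, hf⟩
    have h3 : ‖(⟨f, hf⟩ : V)‖ = ‖f‖ := rfl
    calc ⟪T f, f⟫ = ⟪TV ⟨f, hf⟩, (⟨f, hf⟩ : V)⟫ := rfl
      _ ≤ ‖TV ⟨f, hf⟩‖ * ‖f‖ := h1
      _ ≤ ‖TV‖ * ‖f‖ * ‖f‖ := by gcongr; exact h2
      _ = ‖TV‖ * ‖f‖ ^ 2 := by ring
  have hex : ∃ v : V, v ≠ 0 ∧ TV v = ‖TV‖ • v := by
    by_cases h0 : TV = 0
    · have : Nontrivial V := by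
        by_contra h
        rw [not_nontrivial_iff_subsingleton] at h
        exact hVi inferInstance
      obtain ⟨v, hv⟩ := exists_ne (0 : V)
      exact ⟨v, hv, by rw [h0, ContinuousLinearMap.opNorm_zero, zero_smul]; rfl⟩
    · obtain ⟨v, hv⟩ := (hasEigenvalue_norm_of_isPositive hcV hpV h0).exists_hasEigenvector
      exact ⟨v, hv.2, hv.apply_eq_smul⟩
  obtain ⟨v, hv0, hv⟩ := hex
  have hv0' : ‖(v : E)‖ ≠ 0 := by simpa using hv0
  refine ⟨‖(v : E)‖⁻¹ • v, V.smul_mem _ v.2, ?_, ‖TV‖, TV.opNorm_nonneg, ?_, hbound⟩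
  · rw [norm_smul, norm_inv, norm_norm, inv_mul_cancel₀ hv0']
  · rw [map_smul, ← hTV, hv, smul_comm]; rfl

/-- The state of the recursion that diagonalises a compact operator. -/
structure InvariantPart (T : E →L[ℝ] E) where
  carrier : Submodule ℝ E
  isClosed : IsClosed (carrier : Set E)
  invariant : ∀ v ∈ carrier, T v ∈ carrier
  infinite : ¬ FiniteDimensional ℝ carrier

/-- Symmetry makes the orthogonal complement of an eigenvector invariant, and splitting off one line
cannot make an infinite-dimensional space finite-dimensional. -/
theorem InvariantPart.exists_next {T : E →L[ℝ] E} (hT : T.IsPositive) (V : InvariantPart T)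
    {e : E} {c : ℝ} (heV : e ∈ V.carrier) (he1 : ‖e‖ = 1) (he : T e = c • e) :
    ∃ W : InvariantPart T, W.carrier = V.carrier ⊓ (ℝ ∙ e)ᗮ := by
  refine ⟨⟨V.carrier ⊓ (ℝ ∙ e)ᗮ, ?_, ?_, ?_⟩, rfl⟩
  · exact V.isClosed.inter (Submodule.isClosed_orthogonal _)
  · rintro v ⟨hv, hve⟩
    refine ⟨V.invariant v hv, ?_⟩
    rw [SetLike.mem_coe, Submodule.mem_orthogonal_singleton_iff_inner_right] at hve ⊢
    have := hT.isSymmetric e v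
    simp only [ContinuousLinearMap.coe_coe] at this
    rw [← this, he, inner_smul_left, hve, mul_zero]
  · intro hfin
    apply V.infinite
    have hle : V.carrier ≤ (V.carrier ⊓ (ℝ ∙ e)ᗮ) ⊔ (ℝ ∙ e) := by
      intro v hv
      rw [← sub_add_cancel v (⟪e, v⟫ • e)]
      refine Submodule.add_mem_sup ⟨V.carrier.sub_mem hv (V.carrier.smul_mem _ heV), ?_⟩
        (Submodule.smul_mem _ _ (Submodule.mem_span_singleton_self e))
      rw [SetLike.mem_coe, Submodule.mem_orthogonal_singleton_iff_inner_right, inner_sub_right,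
        inner_smul_right, real_inner_self_eq_norm_sq, he1]
      ring
    exact Submodule.finiteDimensional_of_le hle

/-- Diagonalisation of a positive compact operator on an infinite-dimensional space, with the
eigenvalues in decreasing order; every eigenvalue bounds the quadratic form on the complement of
the preceding eigenvectors. -/
theorem exists_antitone_eigenvector_seq [CompleteSpace E] {T : E →L[ℝ] E}
    (hc : IsCompactOperator T) (hT : T.IsPositive) (hE : ¬ FiniteDimensional ℝ E) :
    ∃ (e : ℕ → E) (c : ℕ → ℝ), Orthonormal ℝ e ∧ Antitone c ∧ (∀ n, 0 ≤ c n) ∧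
      (∀ n, T (e n) = c n • e n) ∧
      ∀ f, (∀ n, ⟪e n, f⟫ = 0) → ∀ n, ⟪T f, f⟫ ≤ c n * ‖f‖ ^ 2 := by
  choose e heV he1 c hc0 heig hbd using fun V : InvariantPart T =>
    exists_top_eigenvector hc hT V.carrier V.isClosed V.invariant V.infinite
  choose next hnext using fun V : InvariantPart T => V.exists_next hT (heV V) (he1 V) (heig V)
  let V0 : InvariantPart T := ⟨⊤, isClosed_univ, fun _ _ => trivial, fun h =>
    hE (Submodule.topEquiv.finiteDimensional)⟩
  let V : ℕ → InvariantPart T := fun n => next^[n] V0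
  have hVs : ∀ n, (V (n + 1)).carrier = (V n).carrier ⊓ (ℝ ∙ e (V n))ᗮ := fun n => by
    simp only [V, Function.iterate_succ_apply']
    exact hnext _
  have hVanti : Antitone fun n => (V n).carrier :=
    antitone_nat_of_succ_le fun n => by rw [hVs]; exact inf_le_left
  have horth : ∀ i j, i < j → ⟪e (V i), e (V j)⟫ = 0 := by
    intro i j hij
    have h1 : e (V j) ∈ (V (i + 1)).carrier := hVanti (Nat.succ_le_of_lt hij) (heV (V j))
    rw [hVs] at h1
    exact Submodule.mem_orthogonal_singleton_iff_inner_right.1 h1.2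
  have hanti : Antitone fun n => c (V n) := by
    refine antitone_nat_of_succ_le fun n => ?_
    -- The next eigenvector still lies in the previous subspace, so testing the quadratic form there
    -- on it compares the two eigenvalues.
    have h := hbd (V n) (e (V (n + 1))) (hVanti n.le_succ (heV _))
    rwa [heig, inner_smul_left, real_inner_self_eq_norm_sq, he1, one_pow, mul_one, mul_one] at h
  refine ⟨fun n => e (V n), fun n => c (V n), ⟨fun n => he1 _, fun i j hij => ?_⟩, hanti,
    fun n => hc0 _, fun n => heig _, fun f hf n => hbd _ _ ?_⟩
  · rcases lt_or_gt_of_ne hij with h | h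
    · exact horth i j h
    · rw [real_inner_comm]; exact horth j i h
  · induction n with
    | zero => exact Submodule.mem_top
    | succ n ih =>
      rw [hVs]
      exact ⟨ih, Submodule.mem_orthogonal_singleton_iff_inner_right.2 (hf n)⟩

end Operators

/-! ### Mercer expansions from feature maps -/

section Mercer

open scoped RealInnerProductSpace

theorem inner_toLp_toLp {α : Type*} [MeasurableSpace α] {μ : Measure α} {f g : α → ℝ}
    (hf : MemLp f 2 μ) (hg : MemLp g 2 μ) : ⟪hf.toLp f, hg.toLp g⟫ = ∫ x, f x * g x ∂μ := by
  rw [L2.inner_def]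
  refine integral_congr_ae ?_
  filter_upwards [hf.coeFn_toLp, hg.coeFn_toLp] with x h1 h2
  rw [h1, h2]
  simp [mul_comm]

/-- The support condition on the input space makes `L²(X)` infinite-dimensional. -/
theorem not_finiteDimensional_L2 {d : ℕ} (hd : 0 < d) {X : Set (Pt d)} (hXne : X.Nonempty)
    (hXfin : volume X ≠ ⊤) (hXsupp : ∀ x ∈ X, ∀ U ∈ 𝓝 x, 0 < volume (X ∩ U)) :
    ¬ FiniteDimensional ℝ (Lp ℝ 2 (volume.restrict X)) := by
  intro hfin
  -- Positive dimension makes finite sets null, so `X` is infinite and contains a sequence of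
  -- disjoint nonempty relatively open sets; their indicators are nonzero and orthogonal.
  have : Nonempty (Fin d) := Fin.pos_iff_nonempty.1 hd
  have hinf : X.Infinite := by
    intro h
    obtain ⟨x, hx⟩ := hXne
    have h1 := hXsupp x hx univ univ_mem
    rw [inter_univ, h.measure_zero] at h1
    exact lt_irrefl _ h1
  have := hinf.to_subtype
  obtain ⟨U, hUi, hUo, hUd⟩ := exists_seq_infinite_isOpen_pairwise_disjoint X
  choose O hO hOU using fun n => isOpen_induced_iff.1 (hUo n)
  have hpos : ∀ n, 0 < (volume.restrict X) (O n) := by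
    intro n
    obtain ⟨x, hx⟩ := (hUi n).nonempty
    rw [Measure.restrict_apply (hO n).measurableSet, inter_comm]
    refine hXsupp x x.2 _ ((hO n).mem_nhds ?_)
    rw [← hOU n] at hx; exact hx
  have hdisj : ∀ i j, i ≠ j → (volume.restrict X) (O i ∩ O j) = 0 := by
    intro i j hij
    rw [Measure.restrict_apply ((hO i).inter (hO j)).measurableSet]
    have hempty : O i ∩ O j ∩ X = ∅ := by
      refine eq_empty_of_forall_notMem ?_
      rintro x ⟨⟨h1, h2⟩, hx⟩
      have hd' : Disjoint (U i) (U j) := hUd hij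
      exact Set.disjoint_left.1 hd' (show (⟨x, hx⟩ : X) ∈ U i by rw [← hOU]; exact h1)
        (by rw [← hOU]; exact h2)
    rw [hempty, measure_empty]
  have hfinm : ∀ n, (volume.restrict X) (O n) ≠ ⊤ := fun n =>
    ((measure_mono (subset_univ _)).trans_lt (by simpa using hXfin.lt_top)).ne
  let v : ℕ → Lp ℝ 2 (volume.restrict X) := fun n =>
    indicatorConstLp 2 (hO n).measurableSet (hfinm n) (1 : ℝ)
  have hli : LinearIndependent ℝ v := by
    refine linearIndependent_of_ne_zero_of_inner_eq_zero (fun n h => ?_) fun i j hij => ?_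
    · have h1 := norm_indicatorConstLp (p := 2) two_ne_zero ENNReal.ofNat_ne_top
        (hs := (hO n).measurableSet) (hμs := hfinm n) (c := (1 : ℝ))
      rw [show indicatorConstLp 2 (hO n).measurableSet (hfinm n) (1 : ℝ) = v n from rfl, h,
        norm_zero, norm_one, one_mul] at h1
      have h2 : 0 < (volume.restrict X).real (O n) := ENNReal.toReal_pos (hpos n).ne' (hfinm n)
      exact (Real.rpow_pos_of_pos h2 _).ne h1
    · simp only [v]
      rw [L2.real_inner_indicatorConstLp_one_indicatorConstLp_one _ _ (hfinm i) (hfinm j)]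
      simp [Measure.real, hdisj i j hij]
  exact not_finite_iff_infinite.2 inferInstance hli.finite

/-- A nonzero value would persist on a relative neighbourhood, which has positive measure by the
support condition. -/
theorem eqOn_zero_of_ae_restrict {d : ℕ} {X : Set (Pt d)}
    (hXsupp : ∀ x ∈ X, ∀ U ∈ 𝓝 x, 0 < volume (X ∩ U)) {g : Pt d → ℝ} (hg : ContinuousOn g X)
    (hXm : MeasurableSet X) (h0 : ∀ᵐ x ∂(volume.restrict X), g x = 0) : ∀ x ∈ X, g x = 0 := by
  intro x hx
  by_contra hne
  have h1 : ∀ᶠ z in 𝓝[X] x, g z ≠ 0 := (hg x hx).eventually_ne hne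
  obtain ⟨U, hU, hUX⟩ := mem_nhdsWithin_iff_exists_mem_nhds_inter.1 h1
  refine (hXsupp x hx U hU).ne' (measure_mono_null ?_ ((ae_restrict_iff' hXm).1 h0))
  rintro z ⟨hzX, hzU⟩ hz
  exact hUX ⟨hzU, hzX⟩ (hz hzX)

variable {d : ℕ} {H : Type*} [NormedAddCommGroup H] [InnerProductSpace ℝ H]

theorem memLp_inner_const {α : Type*} [MeasurableSpace α] {μ : Measure α} {φ : α → H}
    (hφ : MemLp φ 2 μ) (h : H) : MemLp (fun x => ⟪φ x, h⟫) 2 μ := by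
  refine hφ.of_le_mul (c := ‖h‖) (hφ.1.inner aestronglyMeasurable_const) (.of_forall fun x => ?_)
  rw [mul_comm]
  exact norm_inner_le_norm _ _

/-- The operator `h ↦ ⟪φ(·), h⟫` into `L²`, for a square integrable feature map `φ`. -/
noncomputable def featureOp {α : Type*} [MeasurableSpace α] {μ : Measure α} {φ : α → H}
    (hφ : MemLp φ 2 μ) : H →L[ℝ] Lp ℝ 2 μ :=
  LinearMap.mkContinuous
    { toFun := fun h => (memLp_inner_const hφ h).toLp
      map_add' := fun h k => by
        rw [← MemLp.toLp_add]
        exact MemLp.toLp_congr _ _ (.of_forall fun x => inner_add_right _ _ _)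
      map_smul' := fun c h => by
        rw [RingHom.id_apply, ← MemLp.toLp_const_smul]
        exact MemLp.toLp_congr _ _ (.of_forall fun x => inner_smul_right _ _ _) }
    ‖hφ.toLp‖ fun h => by
      rw [mul_comm]
      refine Lp.norm_le_mul_norm_of_ae_le_mul ?_
      filter_upwards [hφ.coeFn_toLp, (memLp_inner_const hφ h).coeFn_toLp] with x h1 h2
      simp only [LinearMap.coe_mk, AddHom.coe_mk]
      rw [h1, h2, mul_comm]
      exact norm_inner_le_norm _ _

theorem featureOp_apply {α : Type*} [MeasurableSpace α] {μ : Measure α} {φ : α → H}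
    (hφ : MemLp φ 2 μ) (h : H) : featureOp hφ h = (memLp_inner_const hφ h).toLp := rfl

/-- This is Bessel's inequality for `φ x`, integrated over `x`. It gives both the compactness of
`featureOp` and the summability of the eigenvalues. -/
theorem sum_norm_featureOp_sq_le {α : Type*} [MeasurableSpace α] {μ : Measure α} {φ : α → H}
    (hφ : MemLp φ 2 μ) {ι : Type*} {v : ι → H} (hv : Orthonormal ℝ v) (s : Finset ι) :
    ∑ i ∈ s, ‖featureOp hφ (v i)‖ ^ 2 ≤ ∫ x, ‖φ x‖ ^ 2 ∂μ := by
  have h1 : ∀ i, ‖featureOp hφ (v i)‖ ^ 2 = ∫ x, ⟪φ x, v i⟫ * ⟪φ x, v i⟫ ∂μ := fun i => by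
    rw [← real_inner_self_eq_norm_sq, featureOp_apply, inner_toLp_toLp]
  have hi : ∀ i, Integrable (fun x => ⟪φ x, v i⟫ * ⟪φ x, v i⟫) μ := fun i =>
    (memLp_inner_const hφ (v i)).integrable_mul (memLp_inner_const hφ (v i))
  simp_rw [h1]
  rw [← integral_finsetSum _ fun i _ => hi i]
  refine integral_mono (integrable_finsetSum _ fun i _ => hi i)
    ((memLp_two_iff_integrable_sq_norm hφ.1).1 hφ) fun x => ?_
  refine le_trans (Finset.sum_le_sum fun i _ => ?_) (hv.sum_inner_products_le (φ x) (s := s))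
  rw [real_inner_comm, Real.norm_eq_abs, sq_abs, sq]

variable [CompleteSpace H]

theorem isCompactOperator_featureOp {α : Type*} [MeasurableSpace α] {μ : Measure α} {φ : α → H}
    (hφ : MemLp φ 2 μ) : IsCompactOperator (featureOp hφ) := by
  obtain ⟨w, b, hb⟩ := exists_hilbertBasis ℝ H
  exact isCompactOperator_of_hilbertSchmidt b _ <|
    summable_of_sum_le (fun _ => sq_nonneg _) (sum_norm_featureOp_sq_le hφ b.orthonormal)

/-- With `A` the adjoint of `S`, the vectors `A eₙ` for positive eigenvalues are orthogonal with
squared norms `cₙ`, and totality of `φ` makes them span a dense subspace. The expansion is then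
Parseval's identity in `H`, which holds at every pair of points and not merely almost everywhere. -/
theorem exists_mercer_of_total (hd : 0 < d) {X : Set (Pt d)} (hXne : X.Nonempty)
    (hXm : MeasurableSet X) (hXfin : volume X ≠ ⊤)
    (hXsupp : ∀ x ∈ X, ∀ U ∈ 𝓝 x, 0 < volume (X ∩ U))
    {φ : Pt d → H} (hφc : ContinuousOn φ X) (hφi : IntegrableOn (fun x => ‖φ x‖ ^ 2) X)
    (htot : ∀ h, (∀ x ∈ X, ⟪φ x, h⟫ = 0) → h = 0) :
    ∃ (ξ : ℕ → ℝ) (ε : ℕ → Pt d → ℝ), IsMercerExpansion X (fun x x' => ⟪φ x, φ x'⟫) ξ ε := by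
  have hφ : MemLp φ 2 (volume.restrict X) :=
    (memLp_two_iff_integrable_sq_norm (hφc.aestronglyMeasurable hXm)).2 hφi
  set S := featureOp hφ with hSdef
  set A := ContinuousLinearMap.adjoint S with hA
  have hpos : (S ∘L A).IsPositive := ContinuousLinearMap.isPositive_self_comp_adjoint S
  have hcomp : IsCompactOperator (S ∘L A) := (isCompactOperator_featureOp hφ).comp_clm A
  obtain ⟨e, c, heo, hcanti, hc0, heig, hbd⟩ := exists_antitone_eigenvector_seq hcomp hpos
    (not_finiteDimensional_L2 hd hXne hXfin hXsupp)
  have hSA : ∀ f h, ⟪A f, h⟫ = ⟪f, S h⟫ := fun f h => S.adjoint_inner_left h f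
  have hAA : ∀ i j, ⟪A (e i), A (e j)⟫ = if i = j then c j else 0 := by
    intro i j
    rw [hSA, ← ContinuousLinearMap.comp_apply, heig, inner_smul_right,
      orthonormal_iff_ite.1 heo i j]
    split_ifs <;> simp
  have hA0 : ∀ i, ¬ 0 < c i → A (e i) = 0 := by
    intro i hi
    rw [← inner_self_eq_zero (𝕜 := ℝ), hAA, if_pos rfl]
    exact le_antisymm (not_lt.1 hi) (hc0 i)
  let J : Set ℕ := {n | 0 < c n}
  let u : J → H := fun n => (√(c n))⁻¹ • A (e n)
  have hsq : ∀ n : J, √(c n) * √(c n) = c n := fun n => Real.mul_self_sqrt (hc0 n)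
  have hsq0 : ∀ n : J, √(c n) ≠ 0 := fun n => (Real.sqrt_pos.2 n.2).ne'
  have huo : Orthonormal ℝ u := by
    rw [orthonormal_iff_ite]
    intro i j
    simp only [u, inner_smul_left, inner_smul_right, hAA]
    by_cases hij : i = j
    · subst hij
      have := hsq0 i
      simp only [if_true]
      rw [← hsq i]; simp; field_simp
    · rw [if_neg hij, if_neg fun h => hij (Subtype.ext h)]; simp
  have hSu : ∀ n : J, ‖S (u n)‖ ^ 2 = c n := by
    intro n
    have : S (A (e n)) = c n • e n := heig n
    simp only [u, map_smul, this, norm_smul, heo.1, mul_one, norm_inv, Real.norm_eq_abs]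
    rw [abs_of_nonneg (Real.sqrt_nonneg _), abs_of_nonneg (hc0 _)]
    have := hsq0 n
    nth_rw 2 [← hsq n]
    field_simp
    rw [sq, hsq]
  have hsum : Summable c := by
    have h1 : Summable fun n : J => c n := by
      refine summable_of_sum_le (fun _ => hc0 _) (c := ∫ x in X, ‖φ x‖ ^ 2) fun s => ?_
      simp_rw [← hSu]
      exact sum_norm_featureOp_sq_le hφ huo s
    refine (summable_subtype_iff_indicator.1 h1).congr fun n => ?_
    by_cases hn : n ∈ J
    · rw [indicator_of_mem hn]
    · rw [indicator_of_notMem hn]; exact (le_antisymm (not_lt.1 hn) (hc0 n)).symm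
  -- If `h` is orthogonal to every `u n`, then `S h` is orthogonal to every `eₙ`, so `‖A (S h)‖² ≤
  -- cₙ ‖S h‖²` for all `n`. Since `cₙ → 0`, `A (S h) = 0`, hence `S h = 0`; by continuity and the
  -- support condition `⟪φ x, h⟫` vanishes at every point of `X`.
  have hutot : (Submodule.span ℝ (range u))ᗮ = ⊥ := by
    rw [eq_bot_iff]
    intro h hh
    have h1 : ∀ n, ⟪A (e n), h⟫ = 0 := by
      intro n
      by_cases hn : 0 < c n
      · have := (Submodule.mem_orthogonal _ _).1 hh (u ⟨n, hn⟩)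
          (Submodule.subset_span (mem_range_self _))
        simp only [u, inner_smul_left] at this
        exact (mul_eq_zero.1 this).resolve_left (by simpa using hsq0 ⟨n, hn⟩)
      · rw [hA0 n hn, inner_zero_left]
    have h2 : A (S h) = 0 := by
      rw [← norm_eq_zero, ← sq_eq_zero_iff, ← real_inner_self_eq_norm_sq]
      refine le_antisymm ?_ real_inner_self_nonneg
      have h3 : ∀ n, ⟪A (S h), A (S h)⟫ ≤ c n * ‖S h‖ ^ 2 := fun n => by
        have := hbd (S h) (fun n => by rw [← hSA]; exact h1 n) n
        rw [hSA, real_inner_comm]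
        exact this
      have h4 := hsum.tendsto_atTop_zero.mul_const (‖S h‖ ^ 2)
      rw [zero_mul] at h4
      exact ge_of_tendsto' h4 h3
    have h3 : S h = 0 := by
      rw [← inner_self_eq_zero (𝕜 := ℝ), ← hSA, h2, inner_zero_left]
    refine htot h (eqOn_zero_of_ae_restrict hXsupp (hφc.inner continuousOn_const) hXm ?_)
    have h4 := (memLp_inner_const hφ h).coeFn_toLp
    rw [← featureOp_apply hφ, ← hSdef, h3] at h4
    filter_upwards [h4, Lp.coeFn_zero ℝ 2 (volume.restrict X)] with x h5 h6
    rw [← h5, h6]; rfl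
  let b := HilbertBasis.mkOfOrthogonalEqBot huo hutot
  have hb : ∀ n, b n = u n := fun n => by simp [b]
  -- For a positive eigenvalue this is the representative for which the eigenvalue equation holds at
  -- every point. For eigenvalue zero any representative works, as `A eₙ = 0` makes both sides
  -- vanish.
  let ε : ℕ → Pt d → ℝ := fun n x => if 0 < c n then (c n)⁻¹ * ⟪φ x, A (e n)⟫ else e n x
  have hε : ∀ n, ε n =ᵐ[volume.restrict X] e n := by
    intro n
    by_cases hn : 0 < c n
    · have h1 : S (A (e n)) = c n • e n := heig n
      have h2 := (memLp_inner_const hφ (A (e n))).coeFn_toLp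
      rw [← featureOp_apply hφ, ← hSdef, h1] at h2
      filter_upwards [h2, Lp.coeFn_smul (c n) (e n)] with x h3 h4
      simp only [ε, if_pos hn]
      rw [← h3, h4, Pi.smul_apply, smul_eq_mul, inv_mul_cancel_left₀ hn.ne']
    · exact .of_forall fun x => if_neg hn
  have hεm : ∀ n, MemLp (ε n) 2 (volume.restrict X) := fun n =>
    (memLp_congr_ae (hε n)).2 (Lp.memLp (e n))
  have hεL : ∀ n, (hεm n).toLp = e n := fun n => by
    rw [MemLp.toLp_congr (hεm n) (Lp.memLp (e n)) (hε n)]; exact Lp.toLp_coeFn _ _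
  refine ⟨c, ε, hcanti, hc0, hεm, fun i j => ?_, fun i x hx => ?_, fun x hx x' hx' => ?_⟩
  · rw [← inner_toLp_toLp (hεm i) (hεm j), hεL, hεL, orthonormal_iff_ite.1 heo i j]
  · have h1 : ∫ x' in X, ⟪φ x, φ x'⟫ * ε i x' = ⟪S (φ x), e i⟫ := by
      rw [← hεL i, hSdef, featureOp_apply, inner_toLp_toLp]
      simp_rw [real_inner_comm (φ x)]
    rw [h1, real_inner_comm, ← hSA, real_inner_comm]
    by_cases hi : 0 < c i
    · simp only [ε, if_pos hi]
      rw [mul_inv_cancel_left₀ hi.ne']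
    · rw [hA0 i hi, le_antisymm (not_lt.1 hi) (hc0 i)]; simp
  · have h1 := b.hasSum_inner_mul_inner (φ x) (φ x')
    simp only [hb] at h1
    have h2 : ∀ n : J, ⟪φ x, u n⟫ * ⟪u n, φ x'⟫ = c n * ε n x * ε n x' := by
      intro n
      have hn : 0 < c n := n.2
      simp only [u, ε, if_pos hn, inner_smul_right, real_inner_comm (φ x')]
      have h3 := hsq n
      have h4 := hsq0 n
      have h5 := hn.ne'
      field_simp
      rw [sq, h3]
      ring
    simp only [h2] at h1
    refine (hasSum_subtype_iff_of_support_subset (f := fun n => c n * ε n x * ε n x') ?_).1 h1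
    intro n hn
    by_contra hnJ
    apply hn
    simp [le_antisymm (not_lt.1 hnJ) (hc0 n)]

/-- A Mercer expansion for the kernel of a continuous square integrable feature map. -/
theorem exists_mercer_of_feature (hd : 0 < d) {X : Set (Pt d)} (hXne : X.Nonempty)
    (hXm : MeasurableSet X) (hXfin : volume X ≠ ⊤)
    (hXsupp : ∀ x ∈ X, ∀ U ∈ 𝓝 x, 0 < volume (X ∩ U))
    {φ : Pt d → H} (hφc : ContinuousOn φ X) (hφi : IntegrableOn (fun x => ‖φ x‖ ^ 2) X)
    {K : Pt d → Pt d → ℝ} (hK : ∀ x ∈ X, ∀ x' ∈ X, K x x' = ⟪φ x, φ x'⟫) :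
    ∃ (ξ : ℕ → ℝ) (ε : ℕ → Pt d → ℝ), IsMercerExpansion X K ξ ε := by
  classical
  -- Shrinking `H` to the closed span of the features makes them total.
  let W : Submodule ℝ H := (Submodule.span ℝ (φ '' X)).topologicalClosure
  have hW : ∀ x ∈ X, φ x ∈ W := fun x hx =>
    Submodule.le_topologicalClosure _ (Submodule.subset_span (mem_image_of_mem φ hx))
  have : CompleteSpace W := (Submodule.isClosed_topologicalClosure _).completeSpace_coe
  let ψ : Pt d → W := fun x => if hx : x ∈ X then ⟨φ x, hW x hx⟩ else 0
  have hψ : ∀ x ∈ X, (ψ x : H) = φ x := fun x hx => by simp [ψ, hx]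
  have hψc : ContinuousOn ψ X := by
    rw [Topology.IsInducing.subtypeVal.continuousOn_iff]
    exact hφc.congr hψ
  have hψi : IntegrableOn (fun x => ‖ψ x‖ ^ 2) X :=
    hφi.congr_fun (fun x hx => by simp only [← hψ x hx, Submodule.coe_norm]) hXm
  have htot : ∀ h : W, (∀ x ∈ X, ⟪ψ x, h⟫ = 0) → h = 0 := by
    intro h hh
    have h1 : (h : H) ∈ (Submodule.span ℝ (φ '' X))ᗮ := by
      rw [Submodule.mem_orthogonal]
      intro v hv
      induction hv using Submodule.span_induction with
      | mem v hv =>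
        obtain ⟨x, hx, rfl⟩ := hv
        rw [← hψ x hx]; exact hh x hx
      | zero => exact inner_zero_left _
      | add v w _ _ h1 h2 => rw [inner_add_left, h1, h2, add_zero]
      | smul c v _ h1 => rw [inner_smul_left, h1, mul_zero]
    rw [← Submodule.orthogonal_closure] at h1
    have h2 := (Submodule.mem_orthogonal _ _).1 h1 h h.2
    exact Subtype.ext (inner_self_eq_zero.1 h2)
  obtain ⟨ξ, ε, h⟩ := exists_mercer_of_total hd hXne hXm hXfin hXsupp hψc hψi htot
  have hKψ : ∀ x ∈ X, ∀ x' ∈ X, K x x' = ⟪ψ x, ψ x'⟫ := fun x hx x' hx' => by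
    rw [hK x hx x' hx', ← hψ x hx, ← hψ x' hx', Submodule.coe_inner]
  refine ⟨ξ, ε, h.antitone, h.nonneg, h.memLp, h.orthonormal, fun i x hx => ?_,
    fun x hx x' hx' => ?_⟩
  · rw [← h.eigen i x hx]
    exact setIntegral_congr_fun hXm fun x' hx' => by simp only [hKψ x hx x' hx']
  · rw [hKψ x hx x' hx']
    exact h.hasSum x hx x' hx'

end Mercer

/-! ### The eigenvalue bound for the variance explained by `m` points -/

section OptimalBound

open scoped RealInnerProductSpace

theorem inner_real_eq_mul (a b : ℝ) : ⟪a, b⟫ = a * b := by simp [mul_comm]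

/-- Fatou's lemma; no dominating function is needed, and integrability of the limit is part of the
conclusion. -/
theorem integrable_and_integral_le_of_tendsto {α : Type*} [MeasurableSpace α] {μ : Measure α}
    {f : ℕ → α → ℝ} {g : α → ℝ} {B : ℝ} (hf : ∀ n, Integrable (f n) μ) (hf0 : ∀ n x, 0 ≤ f n x)
    (hlim : ∀ᵐ x ∂μ, Tendsto (fun n => f n x) atTop (𝓝 (g x))) (hB : ∀ n, ∫ x, f n x ∂μ ≤ B) :
    Integrable g μ ∧ ∫ x, g x ∂μ ≤ B := by
  have hB0 : 0 ≤ B := (integral_nonneg (hf0 0)).trans (hB 0)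
  have hgm : AEStronglyMeasurable g μ := aestronglyMeasurable_of_tendsto_ae atTop
    (fun n => (hf n).1) hlim
  have hg0 : 0 ≤ᵐ[μ] g := by
    filter_upwards [hlim] with x hx
    exact ge_of_tendsto' hx fun n => hf0 n x
  have h1 : ∫⁻ x, ENNReal.ofReal (g x) ∂μ ≤ ENNReal.ofReal B := by
    calc ∫⁻ x, ENNReal.ofReal (g x) ∂μ
        = ∫⁻ x, liminf (fun n => ENNReal.ofReal (f n x)) atTop ∂μ := by
          refine lintegral_congr_ae ?_
          filter_upwards [hlim] with x hx
          exact ((ENNReal.continuous_ofReal.tendsto _).comp hx).liminf_eq.symm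
      _ ≤ liminf (fun n => ∫⁻ x, ENNReal.ofReal (f n x) ∂μ) atTop :=
          lintegral_liminf_le' fun n => (hf n).1.aemeasurable.ennreal_ofReal
      _ ≤ ENNReal.ofReal B := by
          refine liminf_le_of_frequently_le' (Frequently.of_forall fun n => ?_)
          rw [← ofReal_integral_eq_lintegral_ofReal (hf n) (.of_forall (hf0 n))]
          exact ENNReal.ofReal_le_ofReal (hB n)
  refine ⟨⟨hgm, ?_⟩, ?_⟩
  · rw [hasFiniteIntegral_iff_ofReal hg0]
    exact h1.trans_lt ENNReal.ofReal_lt_top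
  · rw [integral_eq_lintegral_of_nonneg_ae hg0 hgm]
    exact ENNReal.toReal_le_of_le_ofReal hB0 h1

/-- Weights in `[0, 1]` of total mass at most `m` are best spent on the first `m` entries of a
decreasing sequence. -/
theorem sum_mul_le_sum_range_of_antitone {c w : ℕ → ℝ} (hc : Antitone c) (hc0 : ∀ n, 0 ≤ c n)
    (hw0 : ∀ i, 0 ≤ w i) (hw1 : ∀ i, w i ≤ 1) {m N : ℕ} (hw : ∑ i ∈ Finset.range N, w i ≤ m) :
    ∑ i ∈ Finset.range N, c i * w i ≤ ∑ i ∈ Finset.range m, c i := by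
  -- Compare with the threshold `c m`: only indices below `m` exceed it, and there the excess is
  -- counted with weight at most one.
  have h1 : ∀ i, c i * w i ≤ c m * w i + if i < m then c i - c m else 0 := by
    intro i
    split_ifs with h
    · have := hc h.le
      nlinarith [hw1 i, hw0 i]
    · have := hc (not_lt.1 h)
      nlinarith [hw0 i]
  calc ∑ i ∈ Finset.range N, c i * w i
      ≤ ∑ i ∈ Finset.range N, (c m * w i + if i < m then c i - c m else 0) :=
        Finset.sum_le_sum fun i _ => h1 i
    _ = c m * ∑ i ∈ Finset.range N, w i +
          ∑ i ∈ Finset.range N with i < m, (c i - c m) := by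
        rw [Finset.sum_add_distrib, Finset.mul_sum, Finset.sum_filter]
    _ ≤ c m * m + ∑ i ∈ Finset.range m, (c i - c m) := by
        refine add_le_add (mul_le_mul_of_nonneg_left hw (hc0 m)) ?_
        refine Finset.sum_le_sum_of_subset_of_nonneg (fun i hi => ?_) fun i hi _ => ?_
        · simp only [Finset.mem_filter] at hi; exact Finset.mem_range.2 hi.2
        · exact sub_nonneg.2 (hc (Finset.mem_range.1 hi).le)
    _ = ∑ i ∈ Finset.range m, c i := by
        rw [Finset.sum_sub_distrib]; simp; ring

variable {d : ℕ} {X : Set (Pt d)} {K : Pt d → Pt d → ℝ} {ξ : ℕ → ℝ} {ε : ℕ → Pt d → ℝ}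

theorem IsMercerExpansion.integrable_mul (hM : IsMercerExpansion X K ξ ε) (i j : ℕ) :
    IntegrableOn (fun x => ε i x * ε j x) X :=
  (hM.memLp i).integrable_mul (hM.memLp j)

/-- On the diagonal the terms are nonnegative with integrals `ξ i`, and their partial sums lie below
the integrable `K x x`. This gives summability and then termwise integration. -/
theorem IsMercerExpansion.hasSum_trace (hM : IsMercerExpansion X K ξ ε) (hXm : MeasurableSet X)
    (hK : IntegrableOn (fun x => K x x) X) : HasSum ξ (∫ x in X, K x x) := by
  let f : ℕ → Pt d → ℝ := fun i x => ξ i * ε i x * ε i x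
  have hf0 : ∀ i x, 0 ≤ f i x := fun i x => by
    simp only [f, mul_assoc]; exact mul_nonneg (hM.nonneg i) (mul_self_nonneg _)
  have hfi : ∀ i, IntegrableOn (f i) X := fun i => by
    simp only [f, mul_assoc]; exact (hM.integrable_mul i i).const_mul _
  have hfint : ∀ i, ∫ x in X, f i x = ξ i := fun i => by
    simp only [f, mul_assoc]
    rw [integral_const_mul, hM.orthonormal, if_pos rfl, mul_one]
  have hsum : Summable ξ := by
    refine summable_of_sum_le hM.nonneg (c := ∫ x in X, K x x) fun s => ?_
    simp_rw [← hfint]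
    rw [← integral_finsetSum _ fun i _ => hfi i]
    refine setIntegral_mono_on (integrable_finsetSum _ fun i _ => hfi i) hK hXm fun x hx => ?_
    exact sum_le_hasSum s (fun i _ => hf0 i x) (hM.hasSum x hx x hx)
  have h1 := hasSum_integral_of_summable_integral_norm (μ := volume.restrict X) hfi (by
    simp_rw [Real.norm_of_nonneg (hf0 _ _), hfint]; exact hsum)
  simp_rw [hfint] at h1
  rwa [setIntegral_congr_fun hXm fun x hx => (hM.hasSum x hx x hx).tsum_eq] at h1

/-- The square summable coordinates of a point in a Mercer expansion. -/
theorem IsMercerExpansion.exists_coordinates (hM : IsMercerExpansion X K ξ ε) :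
    ∃ Φ : Pt d → lp (fun _ : ℕ => ℝ) 2, (∀ x ∈ X, ∀ i, Φ x i = √(ξ i) * ε i x) ∧
      ∀ x ∈ X, ∀ x' ∈ X, ⟪Φ x, Φ x'⟫ = K x x' := by
  classical
  have hmem : ∀ x ∈ X, Memℓp (fun i => √(ξ i) * ε i x) 2 := by
    intro x hx
    refine memℓp_gen ?_
    refine (hM.hasSum x hx x hx).summable.congr fun i => ?_
    simp only [ENNReal.toReal_ofNat, Real.rpow_ofNat, Real.norm_eq_abs, sq_abs, mul_pow,
      Real.sq_sqrt (hM.nonneg i)]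
    ring
  let Φ : Pt d → lp (fun _ : ℕ => ℝ) 2 := fun x => if hx : x ∈ X then ⟨_, hmem x hx⟩ else 0
  have hΦ : ∀ x ∈ X, ∀ i, Φ x i = √(ξ i) * ε i x := fun x hx i => by simp [Φ, hx]
  refine ⟨Φ, hΦ, fun x hx x' hx' => ?_⟩
  refine HasSum.unique ?_ (hM.hasSum x hx x' hx')
  convert! lp.hasSum_inner (𝕜 := ℝ) (Φ x) (Φ x') using 2 with i
  rw [hΦ x hx, hΦ x' hx', inner_real_eq_mul]
  nth_rw 1 [← Real.mul_self_sqrt (hM.nonneg i)]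
  ring

/-- Orthonormality of the `ε i` removes the cross terms. The sum is truncated so that only finite
sums are integrated; the limit is left to Fatou's lemma. -/
theorem integral_sq_sum_coordinates (hM : IsMercerExpansion X K ξ ε) (N : ℕ) (v : ℕ → ℝ) :
    IntegrableOn (fun x => (∑ i ∈ Finset.range N, v i * (√(ξ i) * ε i x)) ^ 2) X ∧
    ∫ x in X, (∑ i ∈ Finset.range N, v i * (√(ξ i) * ε i x)) ^ 2 =
      ∑ i ∈ Finset.range N, ξ i * v i ^ 2 := by
  have h1 : ∀ x, (∑ i ∈ Finset.range N, v i * (√(ξ i) * ε i x)) ^ 2 =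
      ∑ i ∈ Finset.range N, ∑ j ∈ Finset.range N,
        v i * √(ξ i) * (v j * √(ξ j)) * (ε i x * ε j x) := by
    intro x
    rw [sq, Finset.sum_mul_sum]
    exact Finset.sum_congr rfl fun i _ => Finset.sum_congr rfl fun j _ => by ring
  have hi : ∀ i j, IntegrableOn
      (fun x => v i * √(ξ i) * (v j * √(ξ j)) * (ε i x * ε j x)) X := fun i j =>
    (hM.integrable_mul i j).const_mul _
  simp_rw [h1]
  refine ⟨integrable_finsetSum _ fun i _ => integrable_finsetSum _ fun j _ => hi i j, ?_⟩
  rw [integral_finsetSum _ fun i _ => integrable_finsetSum _ fun j _ => hi i j]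
  refine Finset.sum_congr rfl fun i hN => ?_
  rw [integral_finsetSum _ fun j _ => hi i j]
  simp_rw [integral_const_mul, hM.orthonormal]
  rw [Finset.sum_eq_single i (fun j _ hj => by rw [if_neg hj.symm, mul_zero])
    (fun h => absurd hN h), if_pos rfl, mul_one]
  nth_rw 3 [← Real.mul_self_sqrt (hM.nonneg i)]
  ring

/-- The part of the trace of a kernel that is explained by `m` points is at most the sum of its
first `m` eigenvalues. -/
theorem IsMercerExpansion.exists_reduction_bound (hM : IsMercerExpansion X K ξ ε)
    (hXm : MeasurableSet X) {m : ℕ} (pts : Fin m → X) :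
    ∃ G : Pt d → ℝ, IntegrableOn G X ∧ ∫ x in X, G x ≤ ∑ j ∈ Finset.range m, ξ j ∧
      ∀ x ∈ X, ∀ a : Fin m → ℝ,
        2 * ∑ j, a j * K x (pts j) - ∑ j, ∑ k, a j * a k * K (pts j) (pts k) ≤ G x := by
  classical
  obtain ⟨Φ, hΦ, hΦK⟩ := hM.exists_coordinates
  let V : Submodule ℝ (lp (fun _ : ℕ => ℝ) 2) := Submodule.span ℝ (range fun j => Φ (pts j))
  have hVm : Module.finrank ℝ V ≤ m := by
    have h := finrank_range_le_card (R := ℝ) (b := fun j => Φ (pts j))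
    rwa [Fintype.card_fin] at h
  have : FiniteDimensional ℝ V := FiniteDimensional.span_of_finite ℝ (finite_range _)
  let b := stdOrthonormalBasis ℝ V
  let v : Fin (Module.finrank ℝ V) → lp (fun _ : ℕ => ℝ) 2 := fun k => b k
  have hv : Orthonormal ℝ v := b.orthonormal.comp_linearIsometry V.subtypeₗᵢ
  let f : ℕ → Pt d → ℝ := fun N x =>
    ∑ k, (∑ i ∈ Finset.range N, v k i * (√(ξ i) * ε i x)) ^ 2
  -- `w i` is the squared norm of the projection onto `V` of the `i`-th unit vector, so it is at
  -- most one by Bessel; summing over `i` first bounds the total by the dimension of `V`.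
  let w : ℕ → ℝ := fun i => ∑ k, v k i ^ 2
  have hw1 : ∀ i, w i ≤ 1 := by
    intro i
    have h := hv.sum_inner_products_le (lp.single 2 i (1 : ℝ)) (s := Finset.univ)
    rw [lp.norm_single (by norm_num), norm_one, one_pow] at h
    refine le_trans (le_of_eq (Finset.sum_congr rfl fun k _ => ?_)) h
    rw [lp.inner_single_right, inner_real_eq_mul, mul_one, Real.norm_eq_abs, sq_abs]
  have hwm : ∀ N, ∑ i ∈ Finset.range N, w i ≤ m := by
    intro N
    rw [Finset.sum_comm]
    have h : ∀ k, ∑ i ∈ Finset.range N, v k i ^ 2 ≤ 1 := by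
      intro k
      have h1 := lp.hasSum_inner (𝕜 := ℝ) (v k) (v k)
      rw [real_inner_self_eq_norm_sq, hv.1, one_pow] at h1
      refine le_trans (le_of_eq (Finset.sum_congr rfl fun i _ => ?_))
        (sum_le_hasSum (Finset.range N) (fun i _ => real_inner_self_nonneg) h1)
      rw [inner_real_eq_mul, sq]
    refine (Finset.sum_le_sum fun k _ => h k).trans ?_
    simpa using hVm
  have hfi : ∀ N, IntegrableOn (f N) X := fun N =>
    integrable_finsetSum _ fun k _ => (integral_sq_sum_coordinates hM N (v k)).1
  have hfint : ∀ N, ∫ x in X, f N x ≤ ∑ j ∈ Finset.range m, ξ j := by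
    intro N
    simp only [f]
    rw [integral_finsetSum _ fun k _ => (integral_sq_sum_coordinates hM N (v k)).1]
    simp_rw [(integral_sq_sum_coordinates hM N (v _)).2]
    rw [Finset.sum_comm]
    simp_rw [← Finset.mul_sum]
    exact sum_mul_le_sum_range_of_antitone hM.antitone hM.nonneg
      (fun i => Finset.sum_nonneg fun k _ => sq_nonneg _) hw1 (hwm N)
  have hlim : ∀ x ∈ X, Tendsto (fun N => f N x) atTop (𝓝 (∑ k, ⟪v k, Φ x⟫ ^ 2)) := by
    intro x hx
    refine tendsto_finsetSum _ fun k _ => Tendsto.pow ?_ 2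
    refine ((lp.hasSum_inner (𝕜 := ℝ) (v k) (Φ x)).tendsto_sum_nat).congr fun N => ?_
    exact Finset.sum_congr rfl fun i _ => by rw [hΦ x hx, inner_real_eq_mul]
  obtain ⟨hG, hGle⟩ := integrable_and_integral_le_of_tendsto (μ := volume.restrict X) hfi
    (fun N x => Finset.sum_nonneg fun k _ => sq_nonneg _)
    ((ae_restrict_iff' hXm).2 (.of_forall hlim)) hfint
  refine ⟨_, hG, hGle, fun x hx a => ?_⟩
  -- The claim becomes `2⟪p, q⟫ - ‖p‖² ≤ ‖q‖²`. Since it mentions only `K` and arbitrary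
  -- coefficients, the bound carries over from `ℓ²` to any other feature space with the same kernel.
  let p : V := ∑ j, a j • ⟨Φ (pts j), Submodule.subset_span (mem_range_self j)⟩
  have hp : (p : lp (fun _ : ℕ => ℝ) 2) = ∑ j, a j • Φ (pts j) := by
    simp [p]
  let q : V := V.orthogonalProjectionOnto (Φ x)
  have hq : ∀ r : V, ⟪(r : lp (fun _ : ℕ => ℝ) 2), Φ x⟫ = ⟪r, q⟫ := fun r =>
    (Submodule.inner_orthogonalProjectionOnto_eq_of_mem_left r (Φ x)).symm
  have h1 : ∑ j, a j * K x (pts j) = ⟪p, q⟫ := by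
    rw [← hq, hp, sum_inner]
    refine Finset.sum_congr rfl fun j _ => ?_
    rw [real_inner_smul_left, real_inner_comm, hΦK x hx _ (pts j).2]
  have h2 : ∑ j, ∑ k, a j * a k * K (pts j) (pts k) = ‖p‖ ^ 2 := by
    rw [← real_inner_self_eq_norm_sq,
      show ⟪p, p⟫ = ⟪(p : lp (fun _ : ℕ => ℝ) 2), (p : lp (fun _ : ℕ => ℝ) 2)⟫ from rfl, hp,
      sum_inner]
    refine Finset.sum_congr rfl fun j _ => ?_
    rw [inner_sum]
    refine Finset.sum_congr rfl fun k _ => ?_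
    rw [real_inner_smul_left, real_inner_smul_right, hΦK _ (pts j).2 _ (pts k).2, mul_assoc]
  have h3 : ∑ k, ⟪v k, Φ x⟫ ^ 2 = ‖q‖ ^ 2 := by
    rw [← b.sum_sq_norm_inner_right q]
    refine Finset.sum_congr rfl fun k _ => ?_
    rw [Real.norm_eq_abs, sq_abs, ← hq]
  rw [h1, h2, h3]
  have h4 := norm_sub_sq_real p q
  nlinarith [sq_nonneg ‖p - q‖]

end OptimalBound

/-! ### Double differences, Schwarz's theorem, and differentiability from the Gram kernel -/

section DoubleDifference

open scoped RealInnerProductSpace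

/-- The mean value theorem between `0` and `h`, for either sign of `h`. It needs only continuity at
the endpoints, so one-sided derivatives suffice there. -/
theorem exists_sub_eq_mul_of_hasDerivWithinAt {I : Set ℝ} (hI : I.OrdConnected) (h0 : (0 : ℝ) ∈ I)
    {f f' : ℝ → ℝ} (hf : ∀ a ∈ I, HasDerivWithinAt f (f' a) I a) {h : ℝ} (hh : h ∈ I)
    (hne : h ≠ 0) : ∃ c ∈ I, |c| ≤ |h| ∧ f h - f 0 = h * f' c := by
  have key : ∀ a b, a ∈ I → b ∈ I → a < b → ∃ c ∈ Ioo a b, f b - f a = (b - a) * f' c := by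
    intro a b ha hb hab
    have hsub : Icc a b ⊆ I := hI.out ha hb
    obtain ⟨c, hc, h1⟩ := exists_hasDerivAt_eq_slope f f' hab
      (fun x hx => (hf x (hsub hx)).continuousWithinAt.mono hsub) fun x hx =>
        (hf x (hsub (Ioo_subset_Icc_self hx))).hasDerivAt
          (mem_of_superset (Icc_mem_nhds hx.1 hx.2) hsub)
    refine ⟨c, hc, ?_⟩
    rw [h1, mul_div_cancel₀ _ (sub_pos.2 hab).ne']
  rcases lt_or_gt_of_ne hne with hlt | hlt
  · obtain ⟨c, hc, h1⟩ := key h 0 hh h0 hlt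
    refine ⟨c, hI.out hh h0 (Ioo_subset_Icc_self hc), ?_, by linarith⟩
    rw [abs_of_neg hc.2, abs_of_neg hlt]; linarith [hc.1]
  · obtain ⟨c, hc, h1⟩ := key 0 h h0 hh hlt
    refine ⟨c, hI.out h0 hh (Ioo_subset_Icc_self hc), ?_, by linarith⟩
    rw [abs_of_pos hc.1, abs_of_pos hlt]; exact hc.2.le

/-- The double difference of a function is a value of its mixed derivative. -/
theorem exists_double_difference_eq {I J : Set ℝ} (hI : I.OrdConnected) (hJ : J.OrdConnected)
    (hI0 : (0 : ℝ) ∈ I) (hJ0 : (0 : ℝ) ∈ J) {g g₂ g₂₁ : ℝ → ℝ → ℝ}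
    (hg₂ : ∀ s ∈ I, ∀ t ∈ J, HasDerivWithinAt (g s) (g₂ s t) J t)
    (hg₂₁ : ∀ s ∈ I, ∀ t ∈ J, HasDerivWithinAt (fun s => g₂ s t) (g₂₁ s t) I s)
    {h k : ℝ} (hh : h ∈ I) (hk : k ∈ J) (hh0 : h ≠ 0) (hk0 : k ≠ 0) :
    ∃ a ∈ I, ∃ b ∈ J, |a| ≤ |h| ∧ |b| ≤ |k| ∧
      g h k - g h 0 - g 0 k + g 0 0 = h * k * g₂₁ a b := by
  -- The mean value theorem is applied to `g h - g 0` in the second variable, then to `g₂ · b` in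
  -- the first.
  obtain ⟨b, hb, hbk, h1⟩ := exists_sub_eq_mul_of_hasDerivWithinAt hJ hJ0
    (fun t ht => (hg₂ h hh t ht).sub (hg₂ 0 hI0 t ht)) hk hk0
  obtain ⟨a, ha, hah, h2⟩ := exists_sub_eq_mul_of_hasDerivWithinAt hI hI0
    (fun s hs => hg₂₁ s hs b hb) hh hh0
  refine ⟨a, ha, b, hb, hah, hbk, ?_⟩
  simp only [Pi.sub_apply] at h1
  rw [h2] at h1
  linarith

theorem exists_delta_of_continuousWithinAt {I J : Set ℝ} {g : ℝ → ℝ → ℝ}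
    (hc : ContinuousWithinAt (fun p : ℝ × ℝ => g p.1 p.2) (I ×ˢ J) (0, 0)) {η : ℝ} (hη : 0 < η) :
    ∃ δ > 0, ∀ a ∈ I, ∀ b ∈ J, |a| < δ → |b| < δ → |g a b - g 0 0| < η := by
  obtain ⟨δ, hδ, h⟩ := Metric.continuousWithinAt_iff.1 hc η hη
  refine ⟨δ, hδ, fun a ha b hb haδ hbδ => ?_⟩
  have := h (x := (a, b)) ⟨ha, hb⟩ (by simp [Prod.dist_eq, haδ, hbδ])
  simpa [Real.dist_eq] using this

/-- If the mixed derivative `∂₁∂₂g` exists and is continuous, then so does `∂₂∂₁g`, and they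
agree; one-sided derivatives are allowed. -/
theorem hasDerivWithinAt_swap {I J : Set ℝ} (hI : I.OrdConnected) (hJ : J.OrdConnected)
    (hI0 : (0 : ℝ) ∈ I) (hJ0 : (0 : ℝ) ∈ J) (hIn : (𝓝[I \ {0}] (0 : ℝ)).NeBot)
    {g g₂ g₂₁ : ℝ → ℝ → ℝ} {g₁ : ℝ → ℝ}
    (hg₂ : ∀ s ∈ I, ∀ t ∈ J, HasDerivWithinAt (g s) (g₂ s t) J t)
    (hg₂₁ : ∀ s ∈ I, ∀ t ∈ J, HasDerivWithinAt (fun s => g₂ s t) (g₂₁ s t) I s)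
    (hg₁ : ∀ t ∈ J, HasDerivWithinAt (fun s => g s t) (g₁ t) I 0)
    (hc : ContinuousWithinAt (fun p : ℝ × ℝ => g₂₁ p.1 p.2) (I ×ˢ J) (0, 0)) :
    HasDerivWithinAt g₁ (g₂₁ 0 0) J 0 := by
  rw [hasDerivWithinAt_iff_tendsto_slope, Metric.tendsto_nhdsWithin_nhds]
  intro η hη
  obtain ⟨δ, hδ, hclose⟩ := exists_delta_of_continuousWithinAt hc (half_pos hη)
  refine ⟨δ, hδ, fun {k} hk hkδ => ?_⟩
  have hkJ : k ∈ J := hk.1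
  have hk0 : k ≠ 0 := hk.2
  rw [Real.dist_eq, sub_zero] at hkδ
  -- With `k` fixed, letting `h → 0` in the double difference over `h * k` gives the slope of `g₁`;
  -- before the limit it is a value of `g₂₁` near the origin.
  have hlim : Tendsto (fun h => k⁻¹ * (slope (fun s => g s k) 0 h - slope (fun s => g s 0) 0 h))
      (𝓝[I \ {0}] 0) (𝓝 (slope g₁ 0 k)) := by
    rw [slope_def_field, sub_zero, div_eq_inv_mul]
    exact (((hasDerivWithinAt_iff_tendsto_slope.1 (hg₁ k hkJ)).sub
      (hasDerivWithinAt_iff_tendsto_slope.1 (hg₁ 0 hJ0))).const_mul _)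
  have hle : dist (slope g₁ 0 k) (g₂₁ 0 0) ≤ η / 2 := by
    refine le_of_tendsto (hlim.dist tendsto_const_nhds) ?_
    have hball : ∀ᶠ h in 𝓝[I \ {0}] (0 : ℝ), |h| < δ := by
      refine nhdsWithin_le_nhds ?_
      filter_upwards [Metric.ball_mem_nhds (0 : ℝ) hδ] with h hh
      simpa using hh
    filter_upwards [self_mem_nhdsWithin, hball] with h hh hhδ
    have hh0 : h ≠ 0 := hh.2
    obtain ⟨a, ha, b, hb, hah, hbk, h1⟩ :=
      exists_double_difference_eq hI hJ hI0 hJ0 hg₂ hg₂₁ hh.1 hkJ hh0 hk0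
    have h2 : k⁻¹ * (slope (fun s => g s k) 0 h - slope (fun s => g s 0) 0 h) = g₂₁ a b := by
      simp only [slope_def_field, sub_zero]
      field_simp
      linarith
    rw [h2, Real.dist_eq]
    exact (hclose a ha b hb (hah.trans_lt hhδ) (hbk.trans_lt hkδ)).le
  linarith

/-- A Hilbert space valued function is differentiable if the mixed derivative of its Gram kernel
exists and is continuous. -/
theorem exists_hasDerivWithinAt_of_gram {H : Type*} [NormedAddCommGroup H] [InnerProductSpace ℝ H]
    [CompleteSpace H] {I : Set ℝ} (hI : I.OrdConnected) (hI0 : (0 : ℝ) ∈ I)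
    (hIn : (𝓝[I \ {0}] (0 : ℝ)).NeBot) {f : ℝ → H} {g₂ g₂₁ : ℝ → ℝ → ℝ}
    (hg₂ : ∀ s ∈ I, ∀ t ∈ I, HasDerivWithinAt (fun t => ⟪f s, f t⟫) (g₂ s t) I t)
    (hg₂₁ : ∀ s ∈ I, ∀ t ∈ I, HasDerivWithinAt (fun s => g₂ s t) (g₂₁ s t) I s)
    (hc : ContinuousWithinAt (fun p : ℝ × ℝ => g₂₁ p.1 p.2) (I ×ˢ I) (0, 0)) :
    ∃ L, HasDerivWithinAt f L I 0 := by
  simp_rw [hasDerivWithinAt_iff_tendsto_slope]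
  refine cauchy_map_iff_exists_tendsto.1 (Metric.cauchy_iff.2 ⟨hIn.map _, fun η hη => ?_⟩)
  obtain ⟨δ, hδ, hclose⟩ := exists_delta_of_continuousWithinAt hc (η := η ^ 2 / 4) (by positivity)
  refine ⟨slope f 0 '' {h | h ∈ I \ {0} ∧ |h| < δ}, image_mem_map ?_, ?_⟩
  · refine inter_mem self_mem_nhdsWithin (nhdsWithin_le_nhds ?_)
    filter_upwards [Metric.ball_mem_nhds (0 : ℝ) hδ] with h hh
    exact show |h| < δ by simpa using hh
  · rintro _ ⟨h, ⟨⟨hh, hh0⟩, hhδ⟩, rfl⟩ _ ⟨k, ⟨⟨hk, hk0⟩, hkδ⟩, rfl⟩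
    -- All inner products of short difference quotients lie within `η² / 4` of one number, so `‖u -
    -- v‖² = ⟪u, u⟫ - 2⟪u, v⟫ + ⟪v, v⟫` is below `η²`.
    have key : ∀ h k, h ∈ I → k ∈ I → h ≠ 0 → k ≠ 0 → |h| < δ → |k| < δ →
        |⟪slope f 0 h, slope f 0 k⟫ - g₂₁ 0 0| < η ^ 2 / 4 := by
      intro h k hh hk hh0 hk0 hhδ hkδ
      obtain ⟨a, ha, b, hb, hah, hbk, h1⟩ :=
        exists_double_difference_eq (g := fun s t => ⟪f s, f t⟫) hI hI hI0 hI0 hg₂ hg₂₁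
          hh hk hh0 hk0
      have h2 : ⟪slope f 0 h, slope f 0 k⟫ = g₂₁ a b := by
        simp only [slope, vsub_eq_sub, sub_zero, real_inner_smul_left, real_inner_smul_right,
          inner_sub_left, inner_sub_right]
        field_simp
        linarith
      rw [h2]
      exact hclose a ha b hb (hah.trans_lt hhδ) (hbk.trans_lt hkδ)
    have h1 := abs_lt.1 (key h h hh hh hh0 hh0 hhδ hhδ)
    have h2 := abs_lt.1 (key h k hh hk hh0 hk0 hhδ hkδ)
    have h3 := abs_lt.1 (key k k hk hk hk0 hk0 hkδ hkδ)
    rw [dist_eq_norm]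
    refine lt_of_pow_lt_pow_left₀ 2 hη.le ?_
    rw [norm_sub_sq_real, ← real_inner_self_eq_norm_sq, ← real_inner_self_eq_norm_sq]
    linarith

end DoubleDifference

/-! ### Partial derivatives of vector-valued functions on axis-regular domains -/

section VectorPartials

variable {d : ℕ} {V : Type*} [NormedAddCommGroup V] [NormedSpace ℝ V] {D : Set (Pt d)}

/-- `g` is the partial derivative in direction `i` of the vector-valued function `f` on `D`. -/
def HasPartial (D : Set (Pt d)) (i : Fin d) (f g : Pt d → V) : Prop :=
  ∀ x ∈ D, HasDerivWithinAt (fun h : ℝ => f (x + h • EuclideanSpace.single i (1 : ℝ))) (g x)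
    (axisSection D i x) 0

/-- The partial derivative of a vector-valued function. -/
noncomputable def vpartialOn (D : Set (Pt d)) (i : Fin d) (f : Pt d → V) : Pt d → V :=
  fun x => derivWithin (fun h : ℝ => f (x + h • EuclideanSpace.single i (1 : ℝ)))
    (axisSection D i x) 0

/-- Iterated partial derivatives of a vector-valued function. -/
noncomputable def vwordDeriv (D : Set (Pt d)) : List (Fin d) → (Pt d → V) → (Pt d → V)
  | [], f => f
  | i :: w, f => vpartialOn D i (vwordDeriv D w f)

/-- The iterated partial derivatives along a word of a vector-valued function exist. -/
def HasVWordDeriv (D : Set (Pt d)) : List (Fin d) → (Pt d → V) → Prop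
  | [], _ => True
  | i :: w, f => HasVWordDeriv D w f ∧ HasPartial D i (vwordDeriv D w f) (vwordDeriv D (i :: w) f)

theorem zero_mem_axisSection {i : Fin d} {x : Pt d} (hx : x ∈ D) : (0 : ℝ) ∈ axisSection D i x := by
  simpa [axisSection] using hx

/-- Near the base point the admissible steps form a nondegenerate interval. -/
theorem AxisRegular.exists_interval (hD : AxisRegular D) {x : Pt d} (hx : x ∈ D) (i : Fin d) :
    ∃ I : Set ℝ, I.OrdConnected ∧ (0 : ℝ) ∈ I ∧ I ⊆ axisSection D i x ∧
      I ∈ 𝓝[axisSection D i x] 0 ∧ UniqueDiffWithinAt ℝ I 0 := by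
  obtain ⟨δ, hδ, h⟩ := hD x hx i
  have hI : ∃ a b : ℝ, a < b ∧ 0 ∈ Icc a b ∧ axisSection D i x ∩ Icc (-δ) δ = Icc a b := by
    rcases h with h | h | h
    · exact ⟨-δ, δ, by linarith, ⟨by linarith, hδ.le⟩, h⟩
    · exact ⟨0, δ, hδ, ⟨le_rfl, hδ.le⟩, h⟩
    · exact ⟨-δ, 0, by linarith, ⟨by linarith, le_rfl⟩, h⟩
  obtain ⟨a, b, hab, h0, h⟩ := hI
  refine ⟨Icc a b, ordConnected_Icc, h0, ?_, ?_, uniqueDiffOn_Icc hab 0 h0⟩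
  · rw [← h]; exact inter_subset_left
  · rw [← h]
    exact inter_mem self_mem_nhdsWithin
      (nhdsWithin_le_nhds (Icc_mem_nhds (by linarith) hδ))

theorem AxisRegular.uniqueDiffWithinAt (hD : AxisRegular D) {x : Pt d} (hx : x ∈ D) (i : Fin d) :
    UniqueDiffWithinAt ℝ (axisSection D i x) 0 := by
  obtain ⟨I, -, -, hIs, -, hu⟩ := hD.exists_interval hx i
  exact hu.mono hIs

theorem neBot_of_uniqueDiffWithinAt {I : Set ℝ} (h : UniqueDiffWithinAt ℝ I 0) :
    (𝓝[I \ {0}] (0 : ℝ)).NeBot := by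
  have := uniqueDiffWithinAt_iff_accPt.1 h
  rwa [accPt_principal_iff_nhdsWithin] at this

theorem HasPartial.vpartialOn_eq (hD : AxisRegular D) {i : Fin d} {f g : Pt d → V}
    (h : HasPartial D i f g) {x : Pt d} (hx : x ∈ D) : vpartialOn D i f x = g x :=
  (h x hx).derivWithin (hD.uniqueDiffWithinAt hx i)

theorem HasPartial.congr {i : Fin d} {f g f' g' : Pt d → V} (h : HasPartial D i f g)
    (hf : ∀ x ∈ D, f' x = f x) (hg : ∀ x ∈ D, g' x = g x) : HasPartial D i f' g' := by
  intro x hx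
  rw [hg x hx]
  exact (h x hx).congr (fun t ht => hf _ ht) (hf _ (zero_mem_axisSection hx))

theorem vpartialOn_congr {i : Fin d} {f f' : Pt d → V} (hf : ∀ x ∈ D, f' x = f x) {x : Pt d}
    (hx : x ∈ D) : vpartialOn D i f' x = vpartialOn D i f x :=
  derivWithin_congr (fun _ ht => hf _ ht) (hf _ (zero_mem_axisSection hx))

/-- The section through a shifted base point is the translate of the original section, so
derivatives at step `0` everywhere give derivatives at every admissible step. -/
theorem HasPartial.hasDerivWithinAt {i : Fin d} {f g : Pt d → V} (h : HasPartial D i f g)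
    {x : Pt d} {a : ℝ} (ha : a ∈ axisSection D i x) :
    HasDerivWithinAt (fun h : ℝ => f (x + h • EuclideanSpace.single i (1 : ℝ)))
      (g (x + a • EuclideanSpace.single i (1 : ℝ))) (axisSection D i x) a := by
  have h1 := h _ ha
  have h2 : HasDerivWithinAt (fun t : ℝ => t - a) 1 (axisSection D i x) a :=
    (hasDerivWithinAt_id a _).sub_const a
  have h3 := HasDerivWithinAt.scomp_of_eq (h := fun t : ℝ => t - a) (s := axisSection D i x) a h1 h2
    (fun t ht => by
      simp only [axisSection, mem_ofPred_eq] at ht ⊢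
      rwa [add_assoc, ← add_smul, add_sub_cancel]) (sub_self a).symm
  rw [one_smul] at h3
  refine h3.congr_of_mem (fun t _ => ?_) ha
  simp only [Function.comp]
  rw [add_assoc, ← add_smul, add_sub_cancel]

theorem vwordDeriv_real (w : List (Fin d)) (f : Pt d → ℝ) : vwordDeriv D w f = wordDeriv D w f := by
  induction w with
  | nil => rfl
  | cons i w ih => simp only [vwordDeriv, wordDeriv, ih]; rfl

theorem HasPartialOn.hasPartial {i : Fin d} {f : Pt d → ℝ} (h : HasPartialOn D i f) :
    HasPartial D i f (partialOn D i f) := fun x hx => (h x hx).hasDerivWithinAt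

theorem HasVWordDeriv.of_real {w : List (Fin d)} {f : Pt d → ℝ} (h : HasWordDeriv D w f) :
    HasVWordDeriv D w f := by
  induction w with
  | nil => trivial
  | cons i w ih =>
    refine ⟨ih h.1, ?_⟩
    rw [vwordDeriv_real, vwordDeriv_real]
    exact h.2.hasPartial

theorem HasWordDeriv.of_suffix {u w : List (Fin d)} {f : Pt d → ℝ} (h : HasWordDeriv D w f)
    (hu : u <:+ w) : HasWordDeriv D u f := by
  induction w with
  | nil => rw [List.suffix_nil.1 hu]; trivial
  | cons i w ih =>
    rcases List.suffix_cons_iff.1 hu with rfl | hu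
    · exact h
    · exact ih h.1 hu

end VectorPartials

/-! ### Calculus of iterated derivatives -/

section WordDerivatives

open scoped RealInnerProductSpace

variable {d : ℕ} {V W : Type*} [NormedAddCommGroup V] [NormedSpace ℝ V] [NormedAddCommGroup W]
  [NormedSpace ℝ W] {D : Set (Pt d)}

/-- The iterated partial derivative of `f` along `w` exists on `D` and is equal to `g` there. -/
def IsVWordDeriv (D : Set (Pt d)) (w : List (Fin d)) (f g : Pt d → V) : Prop :=
  HasVWordDeriv D w f ∧ ∀ x ∈ D, vwordDeriv D w f x = g x

theorem HasVWordDeriv.isVWordDeriv {w : List (Fin d)} {f : Pt d → V} (h : HasVWordDeriv D w f) :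
    IsVWordDeriv D w f (vwordDeriv D w f) := ⟨h, fun _ _ => rfl⟩

theorem IsVWordDeriv.nil {f g : Pt d → V} (h : ∀ x ∈ D, f x = g x) : IsVWordDeriv D [] f g :=
  ⟨trivial, h⟩

theorem IsVWordDeriv.cons (hD : AxisRegular D) {i : Fin d} {w : List (Fin d)} {f g g' : Pt d → V}
    (h : IsVWordDeriv D w f g) (hg : HasPartial D i g g') : IsVWordDeriv D (i :: w) f g' := by
  have h1 : ∀ x ∈ D, vwordDeriv D (i :: w) f x = g' x := fun x hx => by
    rw [← hg.vpartialOn_eq hD hx]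
    exact vpartialOn_congr h.2 hx
  exact ⟨⟨h.1, hg.congr h.2 h1⟩, h1⟩

/-- Continuous linear maps commute with derivatives. This serves both to pull constant coefficients
out of the kernel and to embed the real mean functions into `L²(P)`. -/
theorem HasVWordDeriv.sum_clm (hD : AxisRegular D) {ι : Type*} (s : Finset ι) (L : ι → V →L[ℝ] W)
    {w : List (Fin d)} {f : ι → Pt d → V} (h : ∀ k, HasVWordDeriv D w (f k)) :
    IsVWordDeriv D w (fun x => ∑ k ∈ s, L k (f k x))
      (fun x => ∑ k ∈ s, L k (vwordDeriv D w (f k) x)) := by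
  induction w with
  | nil => exact .nil fun _ _ => rfl
  | cons i w ih =>
    refine (ih fun k => (h k).1).cons hD fun x hx => ?_
    exact HasDerivWithinAt.fun_sum fun k _ =>
      (L k).hasFDerivAt.comp_hasDerivWithinAt 0 ((h k).2 x hx)

theorem IsVWordDeriv.add (hD : AxisRegular D) {w : List (Fin d)} {f f' g g' : Pt d → V}
    (h : IsVWordDeriv D w f g) (h' : IsVWordDeriv D w f' g') :
    IsVWordDeriv D w (fun x => f x + f' x) (fun x => g x + g' x) := by
  induction w generalizing g g' with
  | nil => exact .nil fun x hx => by rw [h.2 x hx |>.symm, h'.2 x hx |>.symm]; rfl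
  | cons i w ih =>
    refine (ih h.1.1.isVWordDeriv h'.1.1.isVWordDeriv).cons hD fun x hx => ?_
    rw [← h.2 x hx, ← h'.2 x hx]
    exact (h.1.2 x hx).fun_add (h'.1.2 x hx)

/-- Derivatives of functions with values in a closed subspace stay in the subspace. -/
theorem vwordDeriv_mem (hD : AxisRegular D) {U : Submodule ℝ V} (hU : IsClosed (U : Set V))
    {w : List (Fin d)} {f : Pt d → V} (h : HasVWordDeriv D w f) (hf : ∀ x ∈ D, f x ∈ U) {x : Pt d}
    (hx : x ∈ D) : vwordDeriv D w f x ∈ U := by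
  induction w generalizing x with
  | nil => exact hf x hx
  | cons i w ih =>
    have := neBot_of_uniqueDiffWithinAt (hD.uniqueDiffWithinAt hx i)
    refine hU.mem_of_tendsto (hasDerivWithinAt_iff_tendsto_slope.1 (h.2 x hx)) ?_
    filter_upwards [self_mem_nhdsWithin] with t ht
    exact U.smul_mem _ (U.sub_mem (ih h.1 ht.1) (ih h.1 (zero_mem_axisSection hx)))

end WordDerivatives

/-! ### Derivatives of the feature map and of its kernel -/

section Kernel

open scoped RealInnerProductSpace

variable {d : ℕ} {H : Type*} [NormedAddCommGroup H] [InnerProductSpace ℝ H]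
  {D : Set (Pt d)} {R : Pt d → Pt d → ℝ} {Y : Pt d → H}

/-- Inner products of derivatives of a feature map are derivatives of the kernel. -/
theorem inner_vwordDeriv (hD : AxisRegular D) (hY : ∀ s ∈ D, ∀ t ∈ D, ⟪Y s, Y t⟫ = R s t)
    {u v : List (Fin d)} (hu : HasVWordDeriv D u Y) (hv : HasVWordDeriv D v Y) :
    ∀ s ∈ D, ∀ t ∈ D, ⟪vwordDeriv D u Y s, vwordDeriv D v Y t⟫ =
      wordDeriv D u (fun s => wordDeriv D v (R s) t) s := by
  -- The second variable is differentiated first, matching the order in which the kernel derivatives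
  -- are formed.
  have h1 : ∀ s ∈ D, ∀ t ∈ D, ⟪Y s, vwordDeriv D v Y t⟫ = wordDeriv D v (R s) t := by
    intro s hs
    induction v with
    | nil => exact hY s hs
    | cons i v ih =>
      intro t ht
      have h2 : HasPartial D i (fun t => ⟪Y s, vwordDeriv D v Y t⟫)
          (fun t => ⟪Y s, vwordDeriv D (i :: v) Y t⟫) := fun x hx => by
        simpa using (hasDerivWithinAt_const (0 : ℝ) _ (Y s)).inner ℝ (hv.2 x hx)
      rw [← h2.vpartialOn_eq hD ht, vpartialOn_congr (ih hv.1) ht]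
      rfl
  intro s hs t ht
  induction u generalizing s with
  | nil => exact h1 s hs t ht
  | cons i u ih =>
    have h2 : HasPartial D i (fun s => ⟪vwordDeriv D u Y s, vwordDeriv D v Y t⟫)
        (fun s => ⟪vwordDeriv D (i :: u) Y s, vwordDeriv D v Y t⟫) := fun x hx => by
      simpa using (hu.2 x hx).inner ℝ (hasDerivWithinAt_const (0 : ℝ) _ (vwordDeriv D v Y t))
    rw [← h2.vpartialOn_eq hD hs, vpartialOn_congr (fun s hs => ih hu.1 s hs) hs]
    rfl

theorem continuousWithinAt_axis {g : Pt d → Pt d → ℝ}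
    (hg : ContinuousOn (fun p : Pt d × Pt d => g p.1 p.2) (D ×ˢ D)) {s t : Pt d} (hs : s ∈ D)
    (ht : t ∈ D) {i j : Fin d} {I J : Set ℝ} (hI : I ⊆ axisSection D i s)
    (hJ : J ⊆ axisSection D j t) :
    ContinuousWithinAt (fun p : ℝ × ℝ => g (s + p.1 • EuclideanSpace.single i (1 : ℝ))
      (t + p.2 • EuclideanSpace.single j (1 : ℝ))) (I ×ˢ J) (0, 0) := by
  let ψ : ℝ × ℝ → Pt d × Pt d := fun p =>
    (s + p.1 • EuclideanSpace.single i (1 : ℝ), t + p.2 • EuclideanSpace.single j (1 : ℝ))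
  have hψ : Continuous ψ := by fun_prop
  have h0 : ψ (0, 0) = (s, t) := by simp [ψ]
  have h1 := hg (ψ (0, 0)) (by rw [h0]; exact ⟨hs, ht⟩)
  exact h1.comp hψ.continuousWithinAt fun p hp => ⟨hI hp.1, hJ hp.2⟩

theorem LinDiffOp.KernelSmooth.hasPartial_fst {F : LinDiffOp d} (hR : F.KernelSmooth D R)
    {j k : Fin F.L} {l : Fin d} {u v : List (Fin d)} (hu : l :: u <:+ F.word k)
    (hv : v <:+ F.word j) {t : Pt d} (ht : t ∈ D) :
    HasPartial D l (fun s => wordDeriv D u (fun s => wordDeriv D v (R s) t) s)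
      (fun s => wordDeriv D (l :: u) (fun s => wordDeriv D v (R s) t) s) :=
  ((hR.exists_fst j v hv t ht k).of_suffix hu).2.hasPartial

/-- Differentiation in the second variable commutes with the derivatives in the first variable. -/
theorem LinDiffOp.KernelSmooth.hasPartial_snd (hD : AxisRegular D) {F : LinDiffOp d}
    (hR : F.KernelSmooth D R) {j k : Fin F.L} {i : Fin d} {u w : List (Fin d)}
    (hw : i :: w <:+ F.word j) (hu : u <:+ F.word k) {s : Pt d} (hs : s ∈ D) :
    HasPartial D i (fun t => wordDeriv D u (fun s => wordDeriv D w (R s) t) s)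
      (fun t => wordDeriv D u (fun s => wordDeriv D (i :: w) (R s) t) s) := by
  have hw' : w <:+ F.word j := (List.suffix_cons i w).trans hw
  induction u generalizing s with
  | nil => exact ((hR.exists_snd s hs j).of_suffix hw).2.hasPartial
  | cons l u ih =>
    have hu' : u <:+ F.word k := (List.suffix_cons l u).trans hu
    intro t ht
    obtain ⟨I, hI, hI0, hIs, hIn, hIu⟩ := hD.exists_interval hs l
    obtain ⟨J, hJ, hJ0, hJs, hJn, hJu⟩ := hD.exists_interval ht i
    -- Induction on `u`: the `t`-derivative in direction `i`, already known to commute with `u`, is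
    -- moved past the additional letter `l` by Schwarz.
    have h := hasDerivWithinAt_swap hI hJ hI0 hJ0 (neBot_of_uniqueDiffWithinAt hIu)
      (g := fun a b => wordDeriv D u (fun s => wordDeriv D w (R s)
        (t + b • EuclideanSpace.single i (1 : ℝ))) (s + a • EuclideanSpace.single l (1 : ℝ)))
      (g₂ := fun a b => wordDeriv D u (fun s => wordDeriv D (i :: w) (R s)
        (t + b • EuclideanSpace.single i (1 : ℝ))) (s + a • EuclideanSpace.single l (1 : ℝ)))
      (g₂₁ := fun a b => wordDeriv D (l :: u) (fun s => wordDeriv D (i :: w) (R s)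
        (t + b • EuclideanSpace.single i (1 : ℝ))) (s + a • EuclideanSpace.single l (1 : ℝ)))
      (g₁ := fun b => wordDeriv D (l :: u) (fun s => wordDeriv D w (R s)
        (t + b • EuclideanSpace.single i (1 : ℝ))) s)
      (fun a ha b hb => ((ih hu' (hIs ha)).hasDerivWithinAt (hJs hb)).mono hJs)
      (fun a ha b hb => ((hR.hasPartial_fst hu hw (hJs hb)).hasDerivWithinAt (hIs ha)).mono hIs)
      (fun b hb => ((hR.hasPartial_fst hu hw' (hJs hb)) s hs).mono hIs)
      (continuousWithinAt_axis
        (g := fun s t => wordDeriv D (l :: u) (fun s => wordDeriv D (i :: w) (R s) t) s)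
        (hR.continuousOn k j (l :: u) (i :: w) hu hw) hs ht hIs hJs)
    simp only [zero_smul, add_zero] at h
    exact h.mono_of_mem_nhdsWithin hJn

/-- A feature map of a smooth kernel has all the derivatives that occur in the operator. -/
theorem LinDiffOp.KernelSmooth.hasVWordDeriv [CompleteSpace H] (hD : AxisRegular D)
    {F : LinDiffOp d} (hR : F.KernelSmooth D R) (hY : ∀ s ∈ D, ∀ t ∈ D, ⟪Y s, Y t⟫ = R s t)
    {j : Fin F.L} {w : List (Fin d)} (hw : w <:+ F.word j) : HasVWordDeriv D w Y := by
  induction w with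
  | nil => trivial
  | cons i w ih =>
    have hw' : w <:+ F.word j := (List.suffix_cons i w).trans hw
    have hY' := ih hw'
    refine ⟨hY', fun x hx => ?_⟩
    obtain ⟨I, hI, hI0, hIs, hIn, hIu⟩ := hD.exists_interval hx i
    have hin := inner_vwordDeriv hD hY hY' hY'
    -- The Gram kernel of the derivative along `w` is `R` differentiated along `w` in both
    -- variables. Its next `t`-derivative comes from the commutation lemma, the following
    -- `s`-derivative from the smoothness assumption.
    obtain ⟨L, hL⟩ := exists_hasDerivWithinAt_of_gram hI hI0 (neBot_of_uniqueDiffWithinAt hIu)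
      (f := fun h => vwordDeriv D w Y (x + h • EuclideanSpace.single i (1 : ℝ)))
      (g₂ := fun a b => wordDeriv D w (fun s => wordDeriv D (i :: w) (R s)
        (x + b • EuclideanSpace.single i (1 : ℝ))) (x + a • EuclideanSpace.single i (1 : ℝ)))
      (g₂₁ := fun a b => wordDeriv D (i :: w) (fun s => wordDeriv D (i :: w) (R s)
        (x + b • EuclideanSpace.single i (1 : ℝ))) (x + a • EuclideanSpace.single i (1 : ℝ)))
      (fun a ha b hb => (((hR.hasPartial_snd hD hw hw' (hIs ha)).hasDerivWithinAt (hIs hb)).mono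
        hIs).congr_of_mem (fun c hc => hin _ (hIs ha) _ (hIs hc)) hb)
      (fun a ha b hb => ((hR.hasPartial_fst hw hw (hIs hb)).hasDerivWithinAt (hIs ha)).mono hIs)
      (continuousWithinAt_axis
        (g := fun s t => wordDeriv D (i :: w) (fun s => wordDeriv D (i :: w) (R s) t) s)
        (hR.continuousOn j j (i :: w) (i :: w) hw hw) hx hx hIs hIs)
    exact (hL.mono_of_mem_nhdsWithin hIn).differentiableWithinAt.hasDerivWithinAt

/-- The operator applied to a feature map. -/
noncomputable def LinDiffOp.applyFeature (F : LinDiffOp d) (D : Set (Pt d)) (Y : Pt d → H)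
    (x : Pt d) : H :=
  ∑ i, F.coeff i x • vwordDeriv D (F.word i) Y x

/-- In `F.kernel` the coefficients at `x'` stand inside the derivatives in `x`, where they are
constants; linearity takes them out and leaves the double sum of inner products. -/
theorem LinDiffOp.KernelSmooth.inner_applyFeature [CompleteSpace H] (hD : AxisRegular D)
    {F : LinDiffOp d} (hR : F.KernelSmooth D R) (hY : ∀ s ∈ D, ∀ t ∈ D, ⟪Y s, Y t⟫ = R s t)
    {x x' : Pt d} (hx : x ∈ D) (hx' : x' ∈ D) :
    ⟪F.applyFeature D Y x, F.applyFeature D Y x'⟫ = F.kernel D R x x' := by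
  have hv : ∀ i, HasVWordDeriv D (F.word i) Y := fun i =>
    hR.hasVWordDeriv hD hY (j := i) List.suffix_rfl
  simp only [LinDiffOp.applyFeature, LinDiffOp.kernel, LinDiffOp.apply]
  rw [sum_inner]
  refine Finset.sum_congr rfl fun i _ => ?_
  have h := (HasVWordDeriv.sum_clm hD Finset.univ
    (fun j => F.coeff j x' • ContinuousLinearMap.id ℝ ℝ) (w := F.word i)
    (f := fun j s => wordDeriv D (F.word j) (R s) x')
    fun j => .of_real (hR.exists_fst j _ List.suffix_rfl x' hx' i)).2 x hx
  simp only [vwordDeriv_real, _root_.smul_apply, ContinuousLinearMap.id_apply,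
    smul_eq_mul] at h
  rw [h, real_inner_smul_left, inner_sum]
  congr 1
  refine Finset.sum_congr rfl fun j _ => ?_
  rw [real_inner_smul_right, inner_vwordDeriv hD hY (hv i) (hv j) x hx x' hx']

end Kernel

/-! ### Mean-square derivatives as derivatives in `L²(P)` -/

section MeanSquare

open scoped ENNReal

variable {d : ℕ} {Ω : Type*} [MeasurableSpace Ω] {P : Measure Ω} {D : Set (Pt d)}

/-- The extended distance in `Lp` is the `eLpNorm` of the difference, so both sides say that the
same quantity tends to zero. -/
theorem isMSPartial_iff {i : Fin d} {f g : Pt d → Ω → ℝ} {f' g' : Pt d → Lp ℝ 2 P}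
    (hf : ∀ x ∈ D, f x =ᵐ[P] f' x) (hg : ∀ x ∈ D, g x =ᵐ[P] g' x) :
    IsMSPartial P D i f g ↔ HasPartial D i f' g' := by
  refine forall₂_congr fun x hx => ?_
  have h1 : MemLp (g x) 2 P := (memLp_congr_ae (hg x hx)).2 (Lp.memLp _)
  rw [hasDerivWithinAt_iff_tendsto_slope, tendsto_iff_edist_tendsto_0]
  simp only [h1, true_and]
  refine tendsto_congr' ?_
  filter_upwards [self_mem_nhdsWithin] with h hh
  rw [edist_eq_enorm_sub, Lp.enorm_def]
  refine eLpNorm_congr_ae ?_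
  simp only [slope, vsub_eq_sub, sub_zero, zero_smul, add_zero]
  filter_upwards [hf x hx, hf _ hh.1, hg x hx,
    Lp.coeFn_sub (h⁻¹ • (f' (x + h • EuclideanSpace.single i (1 : ℝ)) - f' x)) (g' x),
    Lp.coeFn_smul h⁻¹ (f' (x + h • EuclideanSpace.single i (1 : ℝ)) - f' x),
    Lp.coeFn_sub (f' (x + h • EuclideanSpace.single i (1 : ℝ))) (f' x)] with ω h1 h2 h3 h4 h5 h6
  rw [h4, Pi.sub_apply, h5, Pi.smul_apply, h6, Pi.sub_apply, h1, h2, h3, smul_eq_mul]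

theorem HasVWordDeriv.isMSDeriv {y : Pt d → Ω → ℝ} {y' : Pt d → Lp ℝ 2 P}
    (hy : ∀ x ∈ D, y x =ᵐ[P] y' x) {w : List (Fin d)} (h : HasVWordDeriv D w y') :
    IsMSDeriv P D w y (fun x ω => vwordDeriv D w y' x ω) := by
  induction w with
  | nil => exact fun x hx => (hy x hx).symm
  | cons i w ih =>
    exact ⟨_, ih h.1, (isMSPartial_iff (fun _ _ => .rfl) fun _ _ => .rfl).2 h.2⟩

/-- Mean square derivatives are unique up to modification. -/
theorem IsMSDeriv.ae_eq (hD : AxisRegular D) {y g : Pt d → Ω → ℝ} {y' : Pt d → Lp ℝ 2 P}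
    (hy : ∀ x ∈ D, y x =ᵐ[P] y' x) {w : List (Fin d)} (h : IsMSDeriv P D w y g) :
    ∀ x ∈ D, g x =ᵐ[P] (vwordDeriv D w y' x : Lp ℝ 2 P) := by
  classical
  induction w generalizing g with
  | nil => exact fun x hx => (h x hx).trans (hy x hx)
  | cons i w ih =>
    obtain ⟨k, hk, hg⟩ := h
    let g' : Pt d → Lp ℝ 2 P := fun x => if hx : MemLp (g x) 2 P then hx.toLp else 0
    have hg' : ∀ x ∈ D, g x =ᵐ[P] g' x := fun x hx => by
      simp only [g', dif_pos (hg x hx).1]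
      exact (MemLp.coeFn_toLp _).symm
    have h1 := (isMSPartial_iff (ih hk) hg').1 hg
    intro x hx
    refine (hg' x hx).trans ?_
    rw [← h1.vpartialOn_eq hD hx]
    rfl

end MeanSquare

/-! ### Gaussian subspaces of `L²(P)` and conditional variances -/

section Gaussian

open scoped RealInnerProductSpace ENNReal

variable {Ω : Type*} [MeasurableSpace Ω] {P : Measure Ω}

theorem inner_Lp_eq_integral (U V : Lp ℝ 2 P) : ⟪U, V⟫ = ∫ ω, U ω * V ω ∂P := by
  rw [L2.inner_def]
  simp [mul_comm]

/-- A centred Gaussian element of `L²`. -/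
def IsCentredGaussian (U : Lp ℝ 2 P) : Prop := P.map U = gaussianReal 0 (‖U‖₊ ^ 2)

theorem aemeasurable_Lp (U : Lp ℝ 2 P) : AEMeasurable U P :=
  (Lp.aestronglyMeasurable U).aemeasurable

theorem integral_norm_Lp_le [IsProbabilityMeasure P] (U : Lp ℝ 2 P) : ∫ ω, ‖U ω‖ ∂P ≤ ‖U‖ := by
  rw [integral_norm_eq_lintegral_enorm (Lp.aestronglyMeasurable U), Lp.norm_def,
    ← eLpNorm_one_eq_lintegral_enorm]
  exact ENNReal.toReal_mono (Lp.eLpNorm_ne_top U)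
    (eLpNorm_le_eLpNorm_of_exponent_le one_le_two (Lp.aestronglyMeasurable U))

theorem isCentredGaussian_iff [IsProbabilityMeasure P] (U : Lp ℝ 2 P) :
    IsCentredGaussian U ↔ ∀ t : ℝ, charFun (P.map U) t = Complex.exp (-(t ^ 2 * ‖U‖ ^ 2 / 2)) := by
  have hU : AEMeasurable U P := (Lp.aestronglyMeasurable U).aemeasurable
  have := Measure.isProbabilityMeasure_map hU
  have h : ∀ t : ℝ, charFun (gaussianReal 0 (‖U‖₊ ^ 2)) t =
      Complex.exp (-(t ^ 2 * ‖U‖ ^ 2 / 2)) := fun t => by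
    rw [charFun_gaussianReal]
    congr 1
    simp
    ring
  constructor
  · intro h1 t
    rw [IsCentredGaussian] at h1
    rw [h1, h]
  · intro h1
    exact Measure.ext_of_charFun (funext fun t => by rw [h1, h])

/-- Since `|exp(itu) - exp(itv)| ≤ |t| |u - v|` and the `L¹` norm is at most the `L²` norm, the map
is Lipschitz with constant `|t|`. -/
theorem continuous_charFun_map [IsProbabilityMeasure P] (t : ℝ) :
    Continuous fun U : Lp ℝ 2 P => charFun (P.map U) t := by
  have h1 : ∀ U : Lp ℝ 2 P, charFun (P.map U) t = ∫ ω, Complex.exp (t * U ω * Complex.I) ∂P := by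
    intro U
    rw [charFun_apply_real, integral_map (Lp.aestronglyMeasurable U).aemeasurable]
    exact (by fun_prop :
      Continuous fun x : ℝ => Complex.exp (t * x * Complex.I)).aestronglyMeasurable
  have hint : ∀ U : Lp ℝ 2 P, Integrable (fun ω => Complex.exp (t * U ω * Complex.I)) P := by
    intro U
    refine Integrable.of_bound (C := 1) ?_ (.of_forall fun ω => ?_)
    · exact (by fun_prop : Continuous fun x : ℝ =>
        Complex.exp (t * x * Complex.I)).comp_aestronglyMeasurable (Lp.aestronglyMeasurable U)
    · rw [← Complex.ofReal_mul, Complex.norm_exp_ofReal_mul_I]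
  have key : ∀ U V : Lp ℝ 2 P, dist (charFun (P.map U) t) (charFun (P.map V) t) ≤
      |t| * ‖U - V‖ := by
    intro U V
    rw [h1, h1, dist_eq_norm, ← integral_sub (hint U) (hint V)]
    have hUV : Integrable (fun ω => ‖(U - V : Lp ℝ 2 P) ω‖) P :=
      ((Lp.memLp (U - V)).integrable one_le_two).norm
    calc ‖∫ ω, (Complex.exp (t * U ω * Complex.I) - Complex.exp (t * V ω * Complex.I)) ∂P‖
        ≤ ∫ ω, |t| * ‖(U - V : Lp ℝ 2 P) ω‖ ∂P := by
          refine norm_integral_le_of_norm_le (hUV.const_mul _) ?_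
          filter_upwards [Lp.coeFn_sub U V] with ω hω
          rw [hω, Pi.sub_apply]
          have h2 := Real.norm_exp_I_mul_ofReal_sub_one_le (x := t * U ω - t * V ω)
          have h3 : Complex.exp (t * U ω * Complex.I) - Complex.exp (t * V ω * Complex.I) =
              Complex.exp (((t * V ω : ℝ) : ℂ) * Complex.I) *
                (Complex.exp (Complex.I * ((t * U ω - t * V ω : ℝ) : ℂ)) - 1) := by
            rw [mul_sub, ← Complex.exp_add, mul_one]
            push_cast
            ring_nf
          rw [h3, norm_mul, Complex.norm_exp_ofReal_mul_I, one_mul]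
          refine h2.trans (le_of_eq ?_)
          rw [← mul_sub, norm_mul, Real.norm_eq_abs]
      _ = |t| * ∫ ω, ‖(U - V : Lp ℝ 2 P) ω‖ ∂P := integral_const_mul _ _
      _ ≤ |t| * ‖U - V‖ := by
          gcongr
          exact integral_norm_Lp_le _
  refine LipschitzWith.continuous (K := ⟨|t|, abs_nonneg t⟩)
    (LipschitzWith.of_dist_le_mul fun U V => ?_)
  rw [dist_eq_norm U V]
  exact key U V

/-- For each `t`, the characteristic function condition equates two continuous functions of `U`. -/
theorem isClosed_isCentredGaussian [IsProbabilityMeasure P] :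
    IsClosed {U : Lp ℝ 2 P | IsCentredGaussian U} := by
  simp only [isCentredGaussian_iff, ofPred_forall]
  refine isClosed_iInter fun t => isClosed_eq (continuous_charFun_map t) ?_
  fun_prop

theorem IsCentredGaussian.integral_eq_zero {U : Lp ℝ 2 P} (h : IsCentredGaussian U) :
    ∫ ω, U ω ∂P = 0 := by
  have h1 : ∫ x, x ∂(P.map U) = ∫ ω, U ω ∂P :=
    integral_map (aemeasurable_Lp U) aestronglyMeasurable_id
  rw [← h1, h, integral_id_gaussianReal]

theorem HasGaussianLaw.isCentredGaussian {U : Lp ℝ 2 P} (h : HasGaussianLaw U P)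
    (h0 : ∫ ω, U ω ∂P = 0) : IsCentredGaussian U := by
  have h2 : Var[U; P] = ‖U‖ ^ 2 := by
    rw [variance_of_integral_eq_zero (aemeasurable_Lp U) h0, ← real_inner_self_eq_norm_sq,
      inner_Lp_eq_integral]
    simp [sq]
  rw [IsCentredGaussian, h.map_eq_gaussianReal, h0, h2]
  congr 1
  ext
  simp

theorem HasGaussianLaw.add_const {E : Type*} [NormedAddCommGroup E] [NormedSpace ℝ E]
    [MeasurableSpace E] [BorelSpace E] [SecondCountableTopology E] {X : Ω → E}
    (h : HasGaussianLaw X P) (c : E) : HasGaussianLaw (fun ω => X ω + c) P := by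
  have := h.isGaussian_map
  have h1 : P.map (fun ω => X ω + c) = (P.map X).map (fun x => x + c) :=
    (AEMeasurable.map_map_of_aemeasurable (g := fun x : E => x + c) (by fun_prop)
      h.aemeasurable).symm
  exact ⟨by rw [h1]; infer_instance⟩

/-- The closed linear span of a centred Gaussian process consists of centred Gaussian variables. -/
theorem isCentredGaussian_of_mem_closure_span [IsProbabilityMeasure P] {T : Type*} {y : T → Ω → ℝ}
    (hy : IsGaussianProcess y P) {Y : T → Lp ℝ 2 P} {a : ℝ} {b : T → ℝ}
    (hY : ∀ t, Y t =ᵐ[P] fun ω => a * y t ω + b t) (h0 : ∀ t, ∫ ω, Y t ω ∂P = 0) {U : Lp ℝ 2 P}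
    (hU : U ∈ (Submodule.span ℝ (range Y)).topologicalClosure) : IsCentredGaussian U := by
  have hspan : ∀ U ∈ Submodule.span ℝ (range Y), IsCentredGaussian U := by
    intro U hU
    have hint : ∫ ω, U ω ∂P = 0 := by
      induction hU using Submodule.span_induction with
      | mem v hv => obtain ⟨t, rfl⟩ := hv; exact h0 t
      | zero => rw [integral_congr_ae (Lp.coeFn_zero ℝ 2 P)]; simp
      | add v w _ _ h1 h2 =>
        rw [integral_congr_ae (Lp.coeFn_add v w)]
        simp only [Pi.add_apply]
        rw [integral_add ((Lp.memLp v).integrable one_le_two)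
          ((Lp.memLp w).integrable one_le_two), h1, h2, add_zero]
      | smul c v _ h1 =>
        rw [integral_congr_ae (Lp.coeFn_smul c v)]
        simp only [Pi.smul_apply, integral_smul, h1, smul_zero]
    refine HasGaussianLaw.isCentredGaussian ?_ hint
    obtain ⟨c, rfl⟩ := Finsupp.mem_span_range_iff_exists_finsupp.1 hU
    have h1 := (hy.smul fun t => c t * a).hasGaussianLaw_fun_sum (I := c.support)
    refine (HasGaussianLaw.add_const h1 (∑ t ∈ c.support, c t * b t)).congr ?_
    have h2 : ∀ᵐ ω ∂P, ∀ t ∈ c.support, (c t • Y t : Lp ℝ 2 P) ω = c t * (a * y t ω + b t) := by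
      rw [Finset.eventually_all]
      intro t _
      filter_upwards [hY t, Lp.coeFn_smul (c t) (Y t)] with ω h3 h4
      rw [h4, Pi.smul_apply, h3, smul_eq_mul]
    filter_upwards [h2, Lp.coeFn_finsetSum c.support fun t => c t • Y t] with ω h3 h4
    rw [Finsupp.sum, h4, Finset.sum_apply, Finset.sum_congr rfl h3, ← Finset.sum_add_distrib]
    exact Finset.sum_congr rfl fun t _ => by rw [smul_eq_mul]; ring
  have hcl : closure (Submodule.span ℝ (range Y) : Set (Lp ℝ 2 P)) ⊆ {U | IsCentredGaussian U} :=
    closure_minimal hspan isClosed_isCentredGaussian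
  exact hcl (by rwa [← Submodule.topologicalClosure_coe])

/-- A family in a linear space of centred Gaussian variables is a Gaussian process. -/
theorem isGaussianProcess_of_mem [IsProbabilityMeasure P] {W : Submodule ℝ (Lp ℝ 2 P)}
    (hW : ∀ U ∈ W, IsCentredGaussian U) {T : Type*} {U : T → Lp ℝ 2 P} (hU : ∀ t, U t ∈ W)
    {z : T → Ω → ℝ} {c : T → ℝ} (hz : ∀ t, z t =ᵐ[P] fun ω => U t ω + c t) :
    IsGaussianProcess z P := by
  classical
  have h0 : IsGaussianProcess (fun t ω => U t ω + c t) P := by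
    refine ⟨fun I => ?_⟩
    have h1 : HasGaussianLaw (fun ω (t : I) => U t ω) P := by
      have hm : AEMeasurable (fun ω (t : I) => U t ω) P :=
        aemeasurable_pi_lambda _ fun t => aemeasurable_Lp _
      refine ⟨isGaussian_of_isGaussian_map fun L => ?_⟩
      rw [AEMeasurable.map_map_of_aemeasurable (by fun_prop) hm]
      -- A linear functional of the random vector is a single element of `W`, hence Gaussian.
      let v : Lp ℝ 2 P := ∑ t : I, L (Pi.single t 1) • U t
      have hv : IsCentredGaussian v := hW _ (W.sum_mem fun t _ => W.smul_mem _ (hU t))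
      have h2 : L ∘ (fun ω (t : I) => U t ω) =ᵐ[P] v := by
        have h3 : ∀ᵐ ω ∂P, ∀ t : I, (L (Pi.single t 1) • U t : Lp ℝ 2 P) ω =
            L (Pi.single t 1) * U t ω := by
          rw [eventually_all]
          intro t
          filter_upwards [Lp.coeFn_smul (L (Pi.single t 1)) (U t)] with ω h4
          rw [h4]; rfl
        filter_upwards [h3, Lp.coeFn_finsetSum Finset.univ fun t : I => L (Pi.single t 1) • U t]
          with ω h4 h5
        rw [h5, Finset.sum_apply, Finset.sum_congr rfl fun t _ => h4 t, Function.comp_apply,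
          ← Finset.univ_sum_single (fun t : I => U t ω), map_sum]
        refine Finset.sum_congr rfl fun t _ => ?_
        rw [mul_comm, ← smul_eq_mul, ← map_smul, ← Pi.single_smul, smul_eq_mul, mul_one]
      rw [Measure.map_congr h2, hv]
      infer_instance
    exact HasGaussianLaw.add_const h1 (fun t : I => c t)
  exact h0.congr fun t => (hz t).symm

theorem covariance_eq_inner [IsProbabilityMeasure P] {U V : Lp ℝ 2 P}
    (hU : ∫ ω, U ω ∂P = 0) (hV : ∫ ω, V ω ∂P = 0)
    {X Y : Ω → ℝ} {a b : ℝ} (hX : X =ᵐ[P] fun ω => U ω + a) (hY : Y =ᵐ[P] fun ω => V ω + b) :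
    cov[X, Y; P] = ⟪U, V⟫ := by
  have h : ∀ {U : Lp ℝ 2 P} {X : Ω → ℝ} {a : ℝ}, ∫ ω, U ω ∂P = 0 → X =ᵐ[P] (fun ω => U ω + a) →
      ∫ ω, X ω ∂P = a := by
    intro U X a hU hX
    rw [integral_congr_ae hX, integral_add ((Lp.memLp U).integrable one_le_two)
      (integrable_const _), hU]
    simp
  rw [covariance, h hU hX, h hV hY, inner_Lp_eq_integral]
  refine integral_congr_ae ?_
  filter_upwards [hX, hY] with ω h1 h2
  rw [h1, h2]; ring

/-- The conditional variance of a Gaussian variable given finitely many jointly Gaussian ones is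
the squared distance to their linear span. -/
theorem condVar_ae_eq_of_gaussian {Ω : Type*} {G mΩ : MeasurableSpace Ω} {P : Measure Ω}
    [IsProbabilityMeasure P] {W : Submodule ℝ (Lp ℝ 2 P)}
    (hW : ∀ U ∈ W, IsCentredGaussian U) {m : ℕ} {U : Fin m → Lp ℝ 2 P} {U₀ : Lp ℝ 2 P}
    {S : Submodule ℝ (Lp ℝ 2 P)} [FiniteDimensional ℝ S] (hS : S = Submodule.span ℝ (range U))
    (hU : ∀ j, U j ∈ W) (hU₀ : U₀ ∈ W) {z : Fin m → Ω → ℝ} {ζ : Ω → ℝ} {c : Fin m → ℝ} {c₀ : ℝ}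
    (hzm : ∀ j, Measurable (z j)) (hz : ∀ j, z j =ᵐ[P] fun ω => U j ω + c j)
    (hζ : ζ =ᵐ[P] fun ω => U₀ ω + c₀)
    (hGz : G = MeasurableSpace.comap (fun ω (j : Fin m) => z j ω) inferInstance) :
    condVar G ζ P =ᵐ[P] fun _ => ‖U₀ - S.starProjection U₀‖ ^ 2 := by
  have hG : G ≤ mΩ := hGz ▸ (measurable_pi_lambda _ hzm).comap_le
  set r : Lp ℝ 2 P := U₀ - S.starProjection U₀ with hr
  have hSW : S ≤ W := hS ▸ Submodule.span_le.2 (by rintro _ ⟨j, rfl⟩; exact hU j)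
  have hpS : S.starProjection U₀ ∈ S := S.starProjection_apply_mem U₀
  have hrW : r ∈ W := W.sub_mem hU₀ (hSW hpS)
  have horth : ∀ j, ⟪r, U j⟫ = 0 := fun j =>
    S.starProjection_inner_eq_zero U₀ (U j) (hS ▸ Submodule.subset_span (mem_range_self j))
  obtain ⟨a, ha⟩ : ∃ a : Fin m → ℝ, ∑ j, a j • U j = S.starProjection U₀ :=
    (Submodule.mem_span_range_iff_exists_fun ℝ).1 (by rw [← hS]; exact hpS)
  have hr0 := (hW r hrW).integral_eq_zero
  -- The residual and the observations are made one Gaussian process, so that zero covariance yields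
  -- independence.
  have hgp : IsGaussianProcess (Sum.elim (fun (_ : Unit) => (r : Ω → ℝ)) z) P := by
    refine isGaussianProcess_of_mem hW (U := Sum.elim (fun _ : Unit => r) U)
      (c := Sum.elim (fun _ => 0) c) ?_ ?_
    · rintro (_ | j)
      · exact hrW
      · exact hU j
    · rintro (_ | j)
      · simp
      · exact hz j
  have hind : IndepFun (r : Ω → ℝ) (fun ω j => z j ω) P := by
    have h := hgp.indepFun_of_covariance_eq_zero (fun _ => aemeasurable_Lp r)
      (fun j => (hzm j).aemeasurable) (fun _ j => by
        rw [covariance_eq_inner hr0 (hW _ (hU j)).integral_eq_zero (a := 0) (by simp) (hz j),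
          horth])
    exact h.comp (φ := fun f : Unit → ℝ => f ()) (ψ := id) (measurable_pi_apply _) measurable_id
  have hrm : Measurable (r : Ω → ℝ) := (Lp.stronglyMeasurable r).measurable
  have hindG : Indep (MeasurableSpace.comap (r : Ω → ℝ) inferInstance) G P := hGz ▸ hind
  have hrsm : Measurable[MeasurableSpace.comap (r : Ω → ℝ) inferInstance] (r : Ω → ℝ) :=
    comap_measurable _
  have hce : P[(r : Ω → ℝ) | G] =ᵐ[P] fun _ => 0 := by
    have h := condExp_indep_eq hrm.comap_le hG hrsm.stronglyMeasurable hindG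
    rwa [hr0] at h
  have hce2 : P[(fun ω => r ω ^ 2) | G] =ᵐ[P] fun _ => ‖r‖ ^ 2 := by
    have h := condExp_indep_eq hrm.comap_le hG (hrsm.pow_const 2).stronglyMeasurable hindG
    rw [← real_inner_self_eq_norm_sq, inner_Lp_eq_integral]
    simpa only [sq] using h
  -- `ζ` is the `G`-measurable `g` plus the independent centred residual `r`. Thus `g` is the
  -- conditional mean, and the conditional variance is the unconditional second moment of `r`.
  let g : Ω → ℝ := fun ω => (∑ j, a j * (z j ω - c j)) + c₀
  have hzG : ∀ j, Measurable[G] (z j) := fun j => by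
    have h1 : Measurable[G] (fun ω (j : Fin m) => z j ω) := hGz ▸ comap_measurable _
    exact (measurable_pi_apply j).comp h1
  have hgG : Measurable[G] g :=
    (Finset.measurable_sum _ fun j _ => ((hzG j).sub_const _).const_mul _).add_const _
  have hζg : ζ =ᵐ[P] g + (r : Ω → ℝ) := by
    have h1 : ∀ᵐ ω ∂P, ∀ j, (a j • U j : Lp ℝ 2 P) ω = a j * (z j ω - c j) := by
      rw [eventually_all]
      intro j
      filter_upwards [hz j, Lp.coeFn_smul (a j) (U j)] with ω h2 h3
      rw [h3, Pi.smul_apply, h2, smul_eq_mul, add_sub_cancel_right]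
    filter_upwards [hζ, h1, Lp.coeFn_finsetSum Finset.univ fun j => a j • U j,
      Lp.coeFn_sub U₀ (S.starProjection U₀)] with ω h2 h3 h4 h5
    rw [← ha] at h5
    rw [Pi.add_apply, hr, ← ha, h5, h2, Pi.sub_apply, h4, Finset.sum_apply]
    simp only [g, h3]
    ring
  have hri : Integrable (r : Ω → ℝ) P := (Lp.memLp r).integrable one_le_two
  have hζi : Integrable ζ P :=
    (((Lp.memLp U₀).integrable one_le_two).add (integrable_const c₀)).congr hζ.symm
  have hgi : Integrable g P := by
    refine (hζi.sub hri).congr ?_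
    filter_upwards [hζg] with ω h
    rw [Pi.sub_apply, h, Pi.add_apply, add_sub_cancel_right]
  have hcζ : P[ζ | G] =ᵐ[P] g := by
    refine (condExp_congr_ae hζg).trans ((condExp_add hgi hri G).trans ?_)
    rw [condExp_of_stronglyMeasurable hG hgG.stronglyMeasurable hgi]
    filter_upwards [hce] with ω h
    rw [Pi.add_apply, h, add_zero]
  refine (condExp_congr_ae ?_).trans hce2
  filter_upwards [hcζ, hζg] with ω h1 h2
  rw [Pi.pow_apply, Pi.sub_apply, h1, h2, Pi.add_apply, add_sub_cancel_left]

end Gaussian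

/-! ### The PDE process as an `L²(P)`-valued feature map plus its mean -/

section NormalForm

open scoped RealInnerProductSpace ENNReal

variable {d : ℕ} {Ω : Type*} [MeasurableSpace Ω] {P : Measure Ω} [IsProbabilityMeasure P]

/-- The normalised process as a map into `L²`. -/
theorem IsGPModel.exists_normalised {D : Set (Pt d)} {y : Pt d → Ω → ℝ} {q : ℕ}
    {p : Fin q → Pt d → ℝ} {β : Fin q → ℝ} {σ : ℝ} (hσ : 0 < σ) {R : Pt d → Pt d → ℝ}
    (hy : IsGPModel P D y p β σ R) :
    ∃ Y : Pt d → Lp ℝ 2 P,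
      (∀ x ∈ D, y x =ᵐ[P] fun ω => (σ • Y x) ω + ∑ k, p k x * β k) ∧
      (∀ s ∈ D, ∀ t ∈ D, ⟪Y s, Y t⟫ = R s t) ∧
      ∀ U ∈ (Submodule.span ℝ (range fun x : D => Y x)).topologicalClosure,
        IsCentredGaussian U := by
  classical
  have hmem : ∀ x ∈ D, MemLp (y x) 2 P := fun x hx =>
    (hy.gaussian.hasGaussianLaw_eval ⟨x, hx⟩).memLp_two
  let f : Pt d → Ω → ℝ := fun x ω => σ⁻¹ * y x ω + -(σ⁻¹ * ∑ k, p k x * β k)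
  have hf : ∀ x ∈ D, MemLp (f x) 2 P := fun x hx =>
    ((hmem x hx).const_mul σ⁻¹).add (memLp_const _)
  let Y : Pt d → Lp ℝ 2 P := fun x => if hx : MemLp (f x) 2 P then hx.toLp else 0
  have hYf : ∀ x ∈ D, Y x =ᵐ[P] f x := fun x hx => by
    simp only [Y, dif_pos (hf x hx)]
    exact MemLp.coeFn_toLp _
  have hyY : ∀ x ∈ D, y x =ᵐ[P] fun ω => (σ • Y x) ω + ∑ k, p k x * β k := by
    intro x hx
    filter_upwards [hYf x hx, Lp.coeFn_smul σ (Y x)] with ω h1 h2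
    rw [h2, Pi.smul_apply, h1, smul_eq_mul]
    simp only [f]
    field_simp
    ring
  have hY0 : ∀ x ∈ D, ∫ ω, Y x ω ∂P = 0 := by
    intro x hx
    rw [integral_congr_ae (hYf x hx)]
    simp only [f]
    rw [integral_add (((hmem x hx).integrable one_le_two).const_mul _) (integrable_const _),
      integral_const_mul, hy.mean x hx]
    simp
  refine ⟨Y, hyY, fun s hs t ht => ?_, fun U hU => ?_⟩
  · have h0 : ∀ x ∈ D, ∫ ω, (σ • Y x) ω ∂P = 0 := fun x hx => by
      rw [integral_congr_ae (Lp.coeFn_smul σ (Y x))]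
      simp only [Pi.smul_apply, integral_smul, hY0 x hx, smul_zero]
    have h := covariance_eq_inner (h0 s hs) (h0 t ht) (hyY s hs) (hyY t ht)
    rw [hy.cov s hs t ht, real_inner_smul_left, real_inner_smul_right, ← mul_assoc, ← sq] at h
    exact (mul_left_cancel₀ (pow_ne_zero 2 hσ.ne') h).symm
  · exact isCentredGaussian_of_mem_closure_span hy.gaussian (fun x : D => hYf x x.2)
      (fun x => hY0 x x.2) hU

/-- The PDE process exists, and every version of it is, up to its mean, the operator applied to a
feature map in a space of centred Gaussian variables. -/
theorem IsGPModel.exists_pde_normal_form {X D : Set (Pt d)} (hXD : X ⊆ D) (hD : AxisRegular D)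
    {y : Pt d → Ω → ℝ} {q : ℕ} {p : Fin q → Pt d → ℝ} {β : Fin q → ℝ} {σ : ℝ} (hσ : 0 < σ)
    {R : Pt d → Pt d → ℝ} (hy : IsGPModel P D y p β σ R) {F : LinDiffOp d}
    (hp : ∀ k, F.Exists D (p k)) (hR : F.KernelSmooth D R) :
    ∃ (W : Submodule ℝ (Lp ℝ 2 P)) (U : Pt d → Lp ℝ 2 P) (C : Pt d → ℝ),
      (∀ V ∈ W, IsCentredGaussian V) ∧ (∀ x ∈ X, U x ∈ W) ∧
      (∀ x ∈ X, ∀ x' ∈ X, ⟪U x, U x'⟫ = F.kernel D R x x') ∧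
      (∃ z : Pt d → Ω → ℝ, F.IsPDEVersion P D X y z) ∧
      ∀ z : Pt d → Ω → ℝ, F.IsPDEVersion P D X y z →
        ∀ x ∈ X, Measurable (z x) ∧ z x =ᵐ[P] fun ω => (σ • U x) ω + C x := by
  obtain ⟨Y, hyY, hYR, hW⟩ := hy.exists_normalised hσ
  set W := (Submodule.span ℝ (range fun x : D => Y x)).topologicalClosure with hWdef
  have hYW : ∀ x ∈ D, Y x ∈ W := fun x hx =>
    Submodule.le_topologicalClosure _ (Submodule.subset_span ⟨⟨x, hx⟩, rfl⟩)
  have hYw : ∀ i, HasVWordDeriv D (F.word i) Y := fun i =>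
    hR.hasVWordDeriv hD hYR (j := i) List.suffix_rfl
  let one : Lp ℝ 2 P := Lp.const 2 P (1 : ℝ)
  let L : Fin q → ℝ →L[ℝ] Lp ℝ 2 P := fun k => ContinuousLinearMap.toSpanSingleton ℝ (β k • one)
  -- The sum over `Unit` is just `σ • Y x`, written in the shape that `HasVWordDeriv.sum_clm`
  -- handles.
  let y' : Pt d → Lp ℝ 2 P := fun x => (∑ k, L k (p k x)) + ∑ _j : Unit, (σ • Y x)
  have hLone : ∀ a : Fin q → ℝ, ∑ k, L k (a k) = (∑ k, a k * β k) • one := by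
    intro a
    rw [Finset.sum_smul]
    exact Finset.sum_congr rfl fun k _ => by
      simp only [L, ContinuousLinearMap.toSpanSingleton_apply, smul_smul]
  have hone : ∀ (V : Lp ℝ 2 P) (c : ℝ), ((V + c • one : Lp ℝ 2 P) : Ω → ℝ) =ᵐ[P]
      fun ω => V ω + c := by
    intro V c
    filter_upwards [Lp.coeFn_add V (c • one), Lp.coeFn_smul c one,
      Lp.coeFn_const (p := 2) (μ := P) (1 : ℝ)] with ω h1 h2 h3
    rw [h1, Pi.add_apply, h2, Pi.smul_apply, h3]
    simp
  have hyy' : ∀ x ∈ D, y x =ᵐ[P] y' x := by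
    intro x hx
    refine (hyY x hx).trans ?_
    simp only [y', Finset.univ_unique, Finset.sum_singleton]
    rw [hLone, add_comm]
    exact (hone _ _).symm
  have hy'w : ∀ i, IsVWordDeriv D (F.word i) y' fun x =>
      (∑ k, L k (vwordDeriv D (F.word i) (p k) x)) +
        ∑ _j : Unit, σ • vwordDeriv D (F.word i) Y x := by
    intro i
    exact (HasVWordDeriv.sum_clm hD Finset.univ L fun k => .of_real (hp k i)).add hD
      (HasVWordDeriv.sum_clm hD (Finset.univ : Finset Unit)
        (fun _ => σ • ContinuousLinearMap.id ℝ (Lp ℝ 2 P)) fun _ => hYw i)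
  let C : Pt d → ℝ := fun x =>
    ∑ i, F.coeff i x * ∑ k, vwordDeriv D (F.word i) (p k) x * β k
  have hform : ∀ x ∈ D, F.applyFeature D y' x = σ • F.applyFeature D Y x + C x • one := by
    intro x hx
    simp only [LinDiffOp.applyFeature, C, Finset.smul_sum, Finset.sum_smul]
    rw [← Finset.sum_add_distrib]
    refine Finset.sum_congr rfl fun i _ => ?_
    rw [(hy'w i).2 x hx]
    simp only [hLone, Finset.univ_unique, Finset.sum_singleton]
    rw [smul_add, smul_smul, add_comm, smul_comm σ]
  have hcoe : ∀ x, ((F.applyFeature D y' x : Lp ℝ 2 P) : Ω → ℝ) =ᵐ[P]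
      fun ω => ∑ i, F.coeff i x * vwordDeriv D (F.word i) y' x ω := by
    intro x
    have h1 : ∀ᵐ ω ∂P, ∀ i, (F.coeff i x • vwordDeriv D (F.word i) y' x : Lp ℝ 2 P) ω =
        F.coeff i x * vwordDeriv D (F.word i) y' x ω := by
      rw [eventually_all]
      intro i
      filter_upwards [Lp.coeFn_smul (F.coeff i x) (vwordDeriv D (F.word i) y' x)] with ω h
      rw [h]; rfl
    filter_upwards [h1, Lp.coeFn_finsetSum Finset.univ
      fun i => F.coeff i x • vwordDeriv D (F.word i) y' x] with ω h2 h3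
    simp only [LinDiffOp.applyFeature]
    rw [h3, Finset.sum_apply]
    exact Finset.sum_congr rfl fun i _ => h2 i
  -- `W` is closed, so the derivatives of `Y` remain in it.
  refine ⟨W, F.applyFeature D Y, C, hW, fun x hx => ?_, fun x hx x' hx' => ?_, ?_, ?_⟩
  · exact W.sum_mem fun i _ => W.smul_mem _
      (vwordDeriv_mem hD (Submodule.isClosed_topologicalClosure _) (hYw i) hYW (hXD hx))
  · exact hR.inner_applyFeature hD hYR (hXD hx) (hXD hx')
  · exact ⟨fun x ω => F.applyFeature D y' x ω, fun i x ω => vwordDeriv D (F.word i) y' x ω,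
      fun i => (hy'w i).1.isMSDeriv hyy',
      fun x _ => ⟨(Lp.stronglyMeasurable _).measurable, hcoe x⟩⟩
  · rintro z ⟨g, hg, hz⟩ x hx
    refine ⟨(hz x hx).1, (hz x hx).2.trans ?_⟩
    have h1 : ∀ᵐ ω ∂P, ∀ i, g i x ω = vwordDeriv D (F.word i) y' x ω := by
      rw [eventually_all]
      exact fun i => (hg i).ae_eq hD hyy' x (hXD hx)
    have h2 := hone (σ • F.applyFeature D Y x) (C x)
    rw [← hform x (hXD hx)] at h2
    filter_upwards [h1, h2, hcoe x] with ω h3 h4 h5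
    rw [← h4, h5]
    simp only [h3]

end NormalForm

/-! ### Assembly of the theorem -/

section Main

open scoped RealInnerProductSpace ENNReal

/-- `‖φ z - φ x‖² = K z z - 2 K z x + K x x`, which tends to zero as `z → x`. -/
theorem continuousOn_of_gram {α H : Type*} [TopologicalSpace α] [NormedAddCommGroup H]
    [InnerProductSpace ℝ H] {φ : α → H} {K : α → α → ℝ} {X : Set α}
    (hK : ∀ x ∈ X, ∀ x' ∈ X, ⟪φ x, φ x'⟫ = K x x')
    (hc : ContinuousOn (fun s : α × α => K s.1 s.2) (X ×ˢ X)) : ContinuousOn φ X := by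
  intro x hx
  rw [ContinuousWithinAt, tendsto_iff_norm_sub_tendsto_zero]
  have hdiag : Tendsto (fun z => K z z) (𝓝[X] x) (𝓝 (K x x)) := by
    have h := (hc (x, x) ⟨hx, hx⟩).comp (f := fun z : α => (z, z)) (s := X)
      (by fun_prop : Continuous fun z : α => (z, z)).continuousWithinAt fun z hz => ⟨hz, hz⟩
    exact h
  have hfst : Tendsto (fun z => K z x) (𝓝[X] x) (𝓝 (K x x)) := by
    have h := (hc (x, x) ⟨hx, hx⟩).comp (f := fun z : α => (z, x)) (s := X)
      (by fun_prop : Continuous fun z : α => (z, x)).continuousWithinAt fun z hz => ⟨hz, hx⟩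
    exact h
  have h1 : Tendsto (fun z => K z z - 2 * K z x + K x x) (𝓝[X] x) (𝓝 0) := by
    have := (hdiag.sub (hfst.const_mul 2)).add_const (K x x)
    rwa [show K x x - 2 * K x x + K x x = 0 by ring] at this
  have h2 : Tendsto (fun z => ‖φ z - φ x‖ ^ 2) (𝓝[X] x) (𝓝 0) := by
    refine h1.congr' ?_
    filter_upwards [self_mem_nhdsWithin] with z hz
    rw [norm_sub_sq_real, ← real_inner_self_eq_norm_sq, ← real_inner_self_eq_norm_sq,
      hK z hz z hz, hK z hz x hx, hK x hx x hx]
  have h3 := (Real.continuous_sqrt.tendsto 0).comp h2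
  simpa [Function.comp_def, Real.sqrt_sq] using h3

end Main

theorem mainTheorem3 {d : ℕ} (hd : 0 < d) {Ω : Type*} [MeasurableSpace Ω] (P : Measure Ω)
    [IsProbabilityMeasure P]
    -- the input space `X`, and the set `D ⊇ X` on which the process lives
    (X D : Set (Pt d)) (hXD : X ⊆ D) (hD : AxisRegular D)
    (hXne : X.Nonempty) (hXbdd : Bornology.IsBounded X) (hXmeas : MeasurableSet X)
    (hXsupp : ∀ x ∈ X, ∀ U ∈ 𝓝 x, 0 < volume (X ∩ U))
    -- the Gaussian process model
    (y : Pt d → Ω → ℝ) {q : ℕ} (p : Fin q → Pt d → ℝ) (β : Fin q → ℝ) (σ : ℝ) (hσ : 0 < σ)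
    (R : Pt d → Pt d → ℝ) (hy : IsGPModel P D y p β σ R)
    -- the differential operator, and the existence of the derivatives
    (F : LinDiffOp d) (hp : ∀ k, F.Exists D (p k)) (hR : F.KernelSmooth D R)
    (hRcont : ContinuousOn (fun s : Pt d × Pt d => F.kernel D R s.1 s.2) (X ×ˢ X))
    (hRint : IntegrableOn (fun x => F.kernel D R x x) X) :
    -- the PDE process exists
    (∃ z : Pt d → Ω → ℝ, F.IsPDEVersion P D X y z) ∧
    -- its correlation function has a Mercer expansion
    (∃ (ξ : ℕ → ℝ) (ε : ℕ → Pt d → ℝ), IsMercerExpansion X (F.kernel D R) ξ ε) ∧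
    ∀ z : Pt d → Ω → ℝ, F.IsPDEVersion P D X y z →
      IsGaussianProcess (fun (x : X) ω => z x ω) P ∧
      (∀ x ∈ X, ∀ x' ∈ X, cov[z x, z x'; P] = σ ^ 2 * F.kernel D R x x') ∧
      ∀ m : ℕ,
        (∀ pts : Fin m → X,
          (∀ x ∈ X, condVarAt P z (fun j => (pts j : Pt d)) x =ᵐ[P]
            fun _ => posteriorVar P z (fun j => (pts j : Pt d)) x) ∧
          IntegrableOn (posteriorVar P z fun j => (pts j : Pt d)) X) ∧
        ∀ (ξ : ℕ → ℝ) (ε : ℕ → Pt d → ℝ), IsMercerExpansion X (F.kernel D R) ξ ε →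
          Summable ξ ∧
          BddAbove (range fun pts : Fin m → X => VRR P X z fun j => (pts j : Pt d)) ∧
          ⨆ pts : Fin m → X, VRR P X z (fun j => (pts j : Pt d)) ≤
            (∑ j ∈ Finset.range m, ξ j) / ∑' j, ξ j := by
  obtain ⟨W, U, C, hW, hUW, hUK, hex, hz⟩ := hy.exists_pde_normal_form hXD hD hσ hp hR
  have hUc : ContinuousOn U X := continuousOn_of_gram hUK hRcont
  have hUi : IntegrableOn (fun x => ‖U x‖ ^ 2) X :=
    hRint.congr_fun (fun x hx => by
      simp only; rw [← hUK x hx x hx, real_inner_self_eq_norm_sq]) hXmeas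
  refine ⟨hex, exists_mercer_of_feature hd hXne hXmeas hXbdd.measure_lt_top.ne hXsupp hUc hUi
    (fun x hx x' hx' => (hUK x hx x' hx').symm), fun z hzv => ?_⟩
  replace hz := hz z hzv
  have hσU : ∀ x ∈ X, σ • U x ∈ W := fun x hx => W.smul_mem _ (hUW x hx)
  have hcov : ∀ x ∈ X, ∀ x' ∈ X, cov[z x, z x'; P] = σ ^ 2 * F.kernel D R x x' := by
    intro x hx x' hx'
    rw [covariance_eq_inner (hW _ (hσU x hx)).integral_eq_zero (hW _ (hσU x' hx')).integral_eq_zero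
      (hz x hx).2 (hz x' hx').2, real_inner_smul_left, real_inner_smul_right, hUK x hx x' hx',
      ← mul_assoc, sq]
  have hvar : ∀ x ∈ X, Var[z x; P] = σ ^ 2 * F.kernel D R x x := fun x hx => by
    rw [← covariance_self (hz x hx).1.aemeasurable, hcov x hx x hx]
  have hpost : ∀ {m : ℕ} (pts : Fin m → X), ∃ S : Submodule ℝ (Lp ℝ 2 P),
      ∃ _ : FiniteDimensional ℝ S, S = Submodule.span ℝ (range fun j => σ • U (pts j)) ∧
      (∀ x ∈ X, condVarAt P z (fun j => (pts j : Pt d)) x =ᵐ[P]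
        fun _ => ‖σ • U x - S.starProjection (σ • U x)‖ ^ 2) ∧
      ∀ x ∈ X, posteriorVar P z (fun j => (pts j : Pt d)) x =
        ‖σ • U x - S.starProjection (σ • U x)‖ ^ 2 := by
    intro m pts
    have hfin : FiniteDimensional ℝ (Submodule.span ℝ (range fun j => σ • U (pts j))) :=
      FiniteDimensional.span_of_finite ℝ (finite_range _)
    have h : ∀ x ∈ X, condVarAt P z (fun j => (pts j : Pt d)) x =ᵐ[P] fun _ =>
        ‖σ • U x - (Submodule.span ℝ (range fun j => σ • U (pts j))).starProjection
          (σ • U x)‖ ^ 2 := fun x hx =>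
      condVar_ae_eq_of_gaussian hW rfl (fun j => hσU _ (pts j).2) (hσU x hx)
        (fun j => (hz _ (pts j).2).1) (fun j => (hz _ (pts j).2).2) (hz x hx).2 rfl
    refine ⟨_, hfin, rfl, h, fun x hx => ?_⟩
    rw [posteriorVar, integral_congr_ae (h x hx)]
    simp
  have hpostint : ∀ {m : ℕ} (pts : Fin m → X),
      IntegrableOn (posteriorVar P z fun j => (pts j : Pt d)) X := by
    intro m pts
    obtain ⟨S, hfin, hS, -, hpv⟩ := hpost pts
    have hc : ContinuousOn (fun x => ‖σ • U x - S.starProjection (σ • U x)‖ ^ 2) X :=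
      (((hUc.const_smul σ).sub (S.starProjection.continuous.comp_continuousOn
        (hUc.const_smul σ))).norm).pow 2
    refine IntegrableOn.congr_fun ?_ (fun x hx => (hpv x hx).symm) hXmeas
    -- The residual is a projection onto the orthogonal complement of `S`, hence dominated by `‖σ •
    -- U x‖`.
    refine (hUi.const_mul (σ ^ 2)).mono' (hc.aestronglyMeasurable hXmeas) (.of_forall fun x => ?_)
    have hn : σ ^ 2 * ‖U x‖ ^ 2 = ‖σ • U x‖ ^ 2 := by
      rw [norm_smul, mul_pow, Real.norm_eq_abs, sq_abs]
    rw [Real.norm_of_nonneg (sq_nonneg _), hn]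
    refine pow_le_pow_left₀ (norm_nonneg _) ?_ 2
    have h1 := Sᗮ.norm_starProjection_apply_le (σ • U x)
    rwa [Submodule.starProjection_orthogonal_val] at h1
  refine ⟨isGaussianProcess_of_mem hW (fun x : X => hσU x x.2) fun x => (hz x x.2).2, hcov,
    fun m => ⟨fun pts => ⟨fun x hx => ?_, hpostint pts⟩, fun ξ ε hM => ?_⟩⟩
  · obtain ⟨S, hfin, hS, hcv, hpv⟩ := hpost pts
    rw [hpv x hx]
    exact hcv x hx
  have htr := hM.hasSum_trace hXmeas hRint
  have hvarint : ∫ x in X, Var[z x; P] = σ ^ 2 * ∑' j, ξ j := by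
    rw [setIntegral_congr_fun hXmeas hvar, integral_const_mul, htr.tsum_eq]
  have hσ2 : 0 < σ ^ 2 := by positivity
  have hbound : ∀ pts : Fin m → X, VRR P X z (fun j => (pts j : Pt d)) ≤
      (∑ j ∈ Finset.range m, ξ j) / ∑' j, ξ j := by
    intro pts
    obtain ⟨S, hfin, hS, -, hpv⟩ := hpost pts
    obtain ⟨G, hGi, hGle, hG⟩ := hM.exists_reduction_bound hXmeas pts
    have hle : ∀ x ∈ X, Var[z x; P] - posteriorVar P z (fun j => (pts j : Pt d)) x ≤
        σ ^ 2 * G x := by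
      intro x hx
      -- The coefficients of the projection in `L²(P)`; with them the variance reduction is exactly
      -- `σ²` times the quadratic expression bounded by `G x`.
      obtain ⟨a, ha⟩ : ∃ a : Fin m → ℝ, ∑ j, a j • σ • U (pts j) = S.starProjection (σ • U x) :=
        (Submodule.mem_span_range_iff_exists_fun ℝ).1
          (by rw [← hS]; exact S.starProjection_apply_mem _)
      have h1 : S.starProjection (σ • U x) = σ • ∑ j, a j • U (pts j) := by
        rw [← ha, Finset.smul_sum]
        exact Finset.sum_congr rfl fun j _ => smul_comm _ _ _
      have h2 : inner ℝ (U x) (∑ j, a j • U (pts j)) = ∑ j, a j * F.kernel D R x (pts j) := by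
        rw [inner_sum]
        exact Finset.sum_congr rfl fun j _ => by
          rw [real_inner_smul_right, hUK x hx _ (pts j).2]
      have h3 : ‖∑ j, a j • U (pts j)‖ ^ 2 =
          ∑ j, ∑ k, a j * a k * F.kernel D R (pts j) (pts k) := by
        rw [← real_inner_self_eq_norm_sq, sum_inner]
        refine Finset.sum_congr rfl fun j _ => ?_
        rw [inner_sum]
        exact Finset.sum_congr rfl fun k _ => by
          rw [real_inner_smul_left, real_inner_smul_right, hUK _ (pts j).2 _ (pts k).2, mul_assoc]
      rw [hvar x hx, hpv x hx, h1, ← smul_sub, norm_smul, mul_pow, Real.norm_eq_abs, sq_abs,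
        ← mul_sub, norm_sub_sq_real, ← real_inner_self_eq_norm_sq (U x), hUK x hx x hx, h2, h3]
      refine mul_le_mul_of_nonneg_left ?_ hσ2.le
      linarith [hG x hx a]
    have hvi : IntegrableOn (fun x => Var[z x; P]) X :=
      IntegrableOn.congr_fun (hRint.const_mul (σ ^ 2)) (fun x hx => (hvar x hx).symm) hXmeas
    have hnum : (∫ x in X, Var[z x; P]) - ∫ x in X, posteriorVar P z (fun j => (pts j : Pt d)) x ≤
        σ ^ 2 * ∑ j ∈ Finset.range m, ξ j := by
      rw [← integral_sub hvi (hpostint pts)]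
      refine (setIntegral_mono_on (hvi.sub (hpostint pts)) (hGi.const_mul _) hXmeas hle).trans ?_
      rw [integral_const_mul]
      exact mul_le_mul_of_nonneg_left hGle hσ2.le
    -- Only nonnegativity of the denominator is needed: with zero trace, division by zero makes both
    -- sides zero.
    rw [VRR, hvarint, ← mul_div_mul_left (∑ j ∈ Finset.range m, ξ j) _ hσ2.ne']
    rw [hvarint] at hnum
    exact div_le_div_of_nonneg_right hnum (mul_nonneg hσ2.le (tsum_nonneg hM.nonneg))
  have := hXne.to_subtype
  exact ⟨htr.summable, ⟨_, forall_mem_range.2 hbound⟩, ciSup_le hbound⟩
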